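/- Let $M$ be a connected (finite-dimensional, Hausdorff, second countable) smooth manifold and $\omega$ a $2$-plectic form on $M$, i.e. a smooth closed $3$-form such that $T_mM\to\wedge^2T_m^*M$, $u\mapsto \iota_u\omega$, is injective for every $m$. Let $\mathfrak g$ be a finite-dimensional real Lie algebra and $\mathfrak g\to\mathfrak X(M)$, $x\mapsto v_x$, a Lie algebra morphism such that every $v_x$ is Hamiltonian, i.e. $d\alpha=-\iota_{v_x}\omega$ for some smooth $1$-form $\alpha$. Fix $p\in M$ and let $\omega_{3p}\in\wedge^3\mathfrak g^*$ be the $3$-cocycle $\omega_{3p}(x,y,z)=\omega(v_x,v_y,v_z)|_p$ of $\mathfrak g$ with trivial coefficients; let $[\omega_{3p}]_{\mathfrak g}$ be its class in the Lie algebra cohomology $H^3(\mathfrak g)=H^3(\mathfrak g,\mathbb R)$. Let $L=\mathfrak h[1]\oplus\mathfrak g$ be a minimal Lie $2$-algebra (zero unary bracket) extending $\mathfrak g$, i.e. a finite-dimensional representation $\mathfrak h$ of $\mathfrak g$, written $(x,h)\mapsto[x,h]$, together with a $3$-cocycle $c=[\cdot,\cdot,\cdot]\colon\wedge^3\mathfrak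 g\to\mathfrak h$ with values in this representation. Let $[\mathfrak g,\mathfrak h]\subset\mathfrak h$ be the span of all $[x,h]$, and let $c_{red}\colon\wedge^3\mathfrak g\to\mathfrak h/[\mathfrak g,\mathfrak h]$ be $c$ followed by the projection; it is a $3$-cocycle with values in the trivial representation $\mathfrak h/[\mathfrak g,\mathfrak h]$, with class $[c_{red}]_{\mathfrak g}\in H^3(\mathfrak g,\mathfrak h/[\mathfrak g,\mathfrak h])$. Let $CE(L)$ be the Chevalley-Eilenberg complex of $L$. Its components in degrees $2$ and $3$ are $CE(L)^2=\mathfrak h^*\oplus\wedge^2\mathfrak g^*$ and $CE(L)^3=\wedge^3\mathfrak g^*\oplus(\mathfrak g\otimes\mathfrak h)^*$, with $d(\xi+\varphi)=(d_{\mathfrak g}\varphi-\xi\circ c)+\big(x\otimes h\mapsto-\xi([x,h])\big)$ for $\xi\in\mathfrak h^*$, $\varphi\in\wedge^2\mathfrak g^*$. The element $\omega_{3p}\in\wedge^3\mathfrak g^*\subset CE(L)^3$ is a cocycle of $CE(L)$; let $[\omega_{3p}]_{CE(L)}$ be its class in $H^3(CE(L))$. A moment map for $L$ is an $L_\infty$-morphism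 from $L$ to the Lie $2$-algebra of observables of $(M,\omega)$ whose degree-zero component sends each $x\in\mathfrak g$ to a Hamiltonian $1$-form for $v_x$; explicitly, it consists of linear maps $f_1\colon\mathfrak g\to\Omega^1(M)$, $f_1\colon\mathfrak h\to C^\infty(M)$, $f_2\colon\wedge^2\mathfrak g\to C^\infty(M)$ such that for all $x,y,z\in\mathfrak g$, $h\in\mathfrak h$: $$d(f_1(x))=-\iota_{v_x}\omega,\qquad d(f_1(h))=0,\qquad f_1([x,h])=0,$$ $$d f_2(x,y)=f_1([x,y])-\omega(v_x,v_y,\cdot),$$ $$f_1([x,y,z])+\omega(v_x,v_y,v_z)=f_2(x,[y,z])-f_2(y,[x,z])+f_2(z,[x,y]).$$ Assume that $[\omega_{3p}]_{\mathfrak g}\neq0$, that $H^3(\mathfrak g)$ is one-dimensional, and that $[c_{red}]_{\mathfrak g}\neq0$. Then $[\omega_{3p}]_{CE(L)}=0$. Hence, if moreover the de Rham cohomology $H^1(M)$ vanishes, there exists a moment map for $L=\mathfrak h[1]\oplus\mathfrak g$. -/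

import Mathlib

open scoped Manifold ContDiff Bundle

attribute [local instance 100] LieRing.ofAssociativeRing

noncomputable section

/-! ## Differential forms on a smooth manifold -/

section Forms

variable {n : ℕ} {M : Type*} [TopologicalSpace M] [ChartedSpace (EuclideanSpace ℝ (Fin n)) M]

variable (n M) in
/-- A (not necessarily smooth) differential `k`-form: an alternating `k`-linear form on every
tangent space of `M`. -/
abbrev FormField (k : ℕ) : Type _ :=
  (m : M) → TangentSpace (𝓡 n) m [⋀^Fin k]→L[ℝ] ℝ

/-- The expression of a form in the preferred chart `φ` at `m₀`: the pullback `(φ⁻¹)^* α`. -/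
def FormField.inChart {k : ℕ} (α : FormField n M k) (m₀ : M) :
    EuclideanSpace ℝ (Fin n) → EuclideanSpace ℝ (Fin n) [⋀^Fin k]→L[ℝ] ℝ :=
  fun y => (α ((extChartAt (𝓡 n) m₀).symm y)).compContinuousLinearMap
    (mfderiv 𝓘(ℝ, EuclideanSpace ℝ (Fin n)) (𝓡 n) (extChartAt (𝓡 n) m₀).symm y)

variable (n M) in
/-- The real vector space of smooth `k`-forms: forms that are smooth in charts. -/
def smoothForms (k : ℕ) : Submodule ℝ (FormField n M k) where
  carrier := {α | ∀ m₀ : M, ContDiffOn ℝ ∞ (α.inChart m₀) (extChartAt (𝓡 n) m₀).target}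
  add_mem' := fun {_ _} ha hb m₀ => (ha m₀).add (hb m₀)
  zero_mem' := fun _ => contDiffOn_const (c := 0)
  smul_mem' := fun r _ ha m₀ => (ha m₀).const_smul r

/-- The exterior derivative, computed in charts: at `m` it is `φ^* d ((φ⁻¹)^* α)` for the preferred
chart `φ` at `m`, where the `d` on the right is the exterior derivative on `ℝⁿ`. -/
def FormField.d {k : ℕ} (α : FormField n M k) : FormField n M (k + 1) := fun m =>
  (extDeriv (α.inChart m) (extChartAt (𝓡 n) m m)).compContinuousLinearMap
    (mfderiv (𝓡 n) 𝓘(ℝ, EuclideanSpace ℝ (Fin n)) (extChartAt (𝓡 n) m) m)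

/-- The differential of a function, as a `1`-form. -/
def dFun (f : M → ℝ) : FormField n M 1 := fun m =>
  ContinuousAlternatingMap.ofSubsingleton ℝ (TangentSpace (𝓡 n) m) ℝ (0 : Fin 1)
    (mfderiv (𝓡 n) 𝓘(ℝ, ℝ) f m)

/-- The contraction `i_X α` (the vector field is inserted in the first slot). -/
def FormField.interior {k : ℕ} (X : (m : M) → TangentSpace (𝓡 n) m) (α : FormField n M (k + 1)) :
    FormField n M k := fun m =>
  ContinuousAlternatingMap.curryLeft (𝕜 := ℝ) (E := EuclideanSpace ℝ (Fin n)) (F := ℝ) (α m) (X m)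

theorem FormField.interior_apply {k : ℕ} (X : (m : M) → TangentSpace (𝓡 n) m)
    (α : FormField n M (k + 1)) (m : M) (u : Fin k → TangentSpace (𝓡 n) m) :
    FormField.interior X α m u = α m (Matrix.vecCons (X m) u) := rfl

variable (n M) in
/-- `H¹(M) = 0` in de Rham cohomology: every closed smooth `1`-form is exact. -/
def FirstDeRhamVanishes : Prop :=
  ∀ α ∈ smoothForms n M 1, FormField.d α = 0 → ∃ f : C^∞⟮𝓡 n, M; ℝ⟯, dFun (n := n) (⇑f) = α

/-- A `2`-plectic form: a smooth, closed, nondegenerate `3`-form. -/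
structure IsTwoPlectic (Ω : FormField n M 3) : Prop where
  smooth : Ω ∈ smoothForms n M 3
  closed : FormField.d Ω = 0
  nondegenerate : ∀ (m : M) (u : TangentSpace (𝓡 n) m),
    (∀ a b : TangentSpace (𝓡 n) m, Ω m ![u, a, b] = 0) → u = 0

variable [IsManifold (𝓡 n) ∞ M]

variable (n M) in
/-- Smooth vector fields on `M`. -/
abbrev VectorFields : Type _ :=
  ContMDiffSection (𝓡 n) (EuclideanSpace ℝ (Fin n)) ∞ (TangentSpace (𝓡 n) : M → Type _)

/-- `X` is a Hamiltonian vector field of the `1`-form `α`: `dα = - i_X Ω`. -/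
def IsHamiltonianFor (Ω : FormField n M 3) (α : FormField n M 1) (X : VectorFields n M) : Prop :=
  FormField.d α = -FormField.interior X Ω

/-! ### The brackets of the Lie 2-algebra of observables -/

open Classical in
/-- A Hamiltonian vector field of `α` (unique if `Ω` is nondegenerate; `0` if `α` is not
Hamiltonian). -/
def hamVF (Ω : FormField n M 3) (α : FormField n M 1) : VectorFields n M :=
  if h : ∃ X : VectorFields n M, IsHamiltonianFor Ω α X then h.choose else 0

/-- `ζ(k) = -(-1)^(k(k+1)/2)`. -/
def zetaSign (k : ℕ) : ℝ := -(-1) ^ (k * (k + 1) / 2)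

/-- The binary bracket of Hamiltonian `1`-forms, `[α, β]' = ζ(2) ι_{v_β} ι_{v_α} Ω`. -/
def obsBracket₂ (Ω : FormField n M 3) (α β : FormField n M 1) : FormField n M 1 :=
  zetaSign 2 • FormField.interior (hamVF Ω β) (FormField.interior (hamVF Ω α) Ω)

/-- The trinary bracket of Hamiltonian `1`-forms,
`[α, β, γ]' = ζ(3) ι_{v_γ} ι_{v_β} ι_{v_α} Ω`, a function on `M`. -/
def obsBracket₃ (Ω : FormField n M 3) (α β γ : FormField n M 1) : M → ℝ := fun m =>
  zetaSign 3 * Ω m ![hamVF Ω α m, hamVF Ω β m, hamVF Ω γ m]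

end Forms

/-! ## Lie algebra cohomology in degree three -/

section LieCohomology

variable {𝔤 : Type*} [LieRing 𝔤] [LieAlgebra ℝ 𝔤] {V : Type*} [AddCommGroup V] [Module ℝ V]

/-- Chevalley-Eilenberg differential of a `2`-cochain with values in the representation `ρ`. -/
def ceDiff₂ (ρ : 𝔤 →ₗ⁅ℝ⁆ Module.End ℝ V) (φ : 𝔤 [⋀^Fin 2]→ₗ[ℝ] V) (x y z : 𝔤) : V :=
  ρ x (φ ![y, z]) - ρ y (φ ![x, z]) + ρ z (φ ![x, y])
    - φ ![⁅x, y⁆, z] + φ ![⁅x, z⁆, y] - φ ![⁅y, z⁆, x]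

/-- Chevalley-Eilenberg differential of a `3`-cochain with values in the representation `ρ`. -/
def ceDiff₃ (ρ : 𝔤 →ₗ⁅ℝ⁆ Module.End ℝ V) (θ : 𝔤 [⋀^Fin 3]→ₗ[ℝ] V) (x y z u : 𝔤) : V :=
  ρ x (θ ![y, z, u]) - ρ y (θ ![x, z, u]) + ρ z (θ ![x, y, u]) - ρ u (θ ![x, y, z])
    - θ ![⁅x, y⁆, z, u] + θ ![⁅x, z⁆, y, u] - θ ![⁅x, u⁆, y, z]
    - θ ![⁅y, z⁆, x, u] + θ ![⁅y, u⁆, x, z] - θ ![⁅z, u⁆, x, y]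

/-- `3`-cocycles of `𝔤` with values in the representation `ρ`. -/
def lieCocycles₃ (ρ : 𝔤 →ₗ⁅ℝ⁆ Module.End ℝ V) : Submodule ℝ (𝔤 [⋀^Fin 3]→ₗ[ℝ] V) where
  carrier := {θ | ∀ x y z u : 𝔤, ceDiff₃ ρ θ x y z u = 0}
  add_mem' := fun {a b} ha hb x y z u => by
    have h1 := ha x y z u
    have h2 := hb x y z u
    have h3 : ceDiff₃ ρ (a + b) x y z u = ceDiff₃ ρ a x y z u + ceDiff₃ ρ b x y z u := by
      simp only [ceDiff₃, AlternatingMap.add_apply, map_add]; abel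
    rw [h3, h1, h2, add_zero]
  zero_mem' := fun x y z u => by simp [ceDiff₃]
  smul_mem' := fun r a ha x y z u => by
    have h1 := ha x y z u
    have h3 : ceDiff₃ ρ (r • a) x y z u = r • ceDiff₃ ρ a x y z u := by
      simp only [ceDiff₃, AlternatingMap.smul_apply, map_smul]; module
    rw [h3, h1, smul_zero]

/-- `3`-coboundaries of `𝔤` with values in the representation `ρ`. -/
def lieCoboundaries₃ (ρ : 𝔤 →ₗ⁅ℝ⁆ Module.End ℝ V) : Submodule ℝ (𝔤 [⋀^Fin 3]→ₗ[ℝ] V) where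
  carrier := {θ | ∃ φ : 𝔤 [⋀^Fin 2]→ₗ[ℝ] V, ∀ x y z : 𝔤, θ ![x, y, z] = ceDiff₂ ρ φ x y z}
  add_mem' := by
    rintro a b ⟨φ, hφ⟩ ⟨ψ, hψ⟩
    refine ⟨φ + ψ, fun x y z => ?_⟩
    rw [AlternatingMap.add_apply, hφ, hψ]
    simp only [ceDiff₂, AlternatingMap.add_apply, map_add]; abel
  zero_mem' := ⟨0, fun x y z => by simp [ceDiff₂]⟩
  smul_mem' := by
    rintro r a ⟨φ, hφ⟩
    refine ⟨r • φ, fun x y z => ?_⟩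
    rw [AlternatingMap.smul_apply, hφ]
    simp only [ceDiff₂, AlternatingMap.smul_apply, map_smul]; module

/-- The Lie algebra cohomology `H³(𝔤, V)`: cocycles modulo coboundaries. -/
abbrev LieH₃ (ρ : 𝔤 →ₗ⁅ℝ⁆ Module.End ℝ V) : Type _ :=
  lieCocycles₃ ρ ⧸ (lieCoboundaries₃ ρ).comap (lieCocycles₃ ρ).subtype

/-- The class of a cocycle in `H³(𝔤, V)`. -/
def lieClass₃ (ρ : 𝔤 →ₗ⁅ℝ⁆ Module.End ℝ V) (θ : 𝔤 [⋀^Fin 3]→ₗ[ℝ] V) (hθ : θ ∈ lieCocycles₃ ρ) :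
    LieH₃ ρ :=
  Submodule.Quotient.mk ⟨θ, hθ⟩

variable (𝔤 V) in
/-- The trivial representation of `𝔤` on `V`. -/
abbrev trivialRep : 𝔤 →ₗ⁅ℝ⁆ Module.End ℝ V := 0

end LieCohomology

/-! ## Minimal Lie 2-algebras -/

/-- A minimal Lie 2-algebra `𝔥[1] ⊕ 𝔤` (vanishing unary bracket) whose binary bracket on `𝔤` is the
given Lie bracket: the binary bracket `𝔤 ⊗ 𝔥 → 𝔥` and the trinary bracket `∧³𝔤 → 𝔥`. The higher
Jacobi identities say that the first is a representation and the second a `3`-cocycle for it. -/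
structure MinimalLie2Algebra (𝔤 𝔥 : Type*) [LieRing 𝔤] [LieAlgebra ℝ 𝔤]
    [AddCommGroup 𝔥] [Module ℝ 𝔥] where
  act : 𝔤 →ₗ⁅ℝ⁆ Module.End ℝ 𝔥
  trinary : 𝔤 [⋀^Fin 3]→ₗ[ℝ] 𝔥
  trinary_cocycle : trinary ∈ lieCocycles₃ act

namespace MinimalLie2Algebra

variable {𝔤 𝔥 : Type*} [LieRing 𝔤] [LieAlgebra ℝ 𝔤] [AddCommGroup 𝔥] [Module ℝ 𝔥]
  (L : MinimalLie2Algebra 𝔤 𝔥)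

/-- The subspace `[𝔤, 𝔥]` of `𝔥` spanned by all brackets `[x, h]`. -/
def bracketSpan : Submodule ℝ 𝔥 :=
  Submodule.span ℝ {w | ∃ (x : 𝔤) (h : 𝔥), L.act x h = w}

/-- `c_red = pr ∘ c`, with values in `𝔥 / [𝔤, 𝔥]`. -/
def cRed : 𝔤 [⋀^Fin 3]→ₗ[ℝ] (𝔥 ⧸ L.bracketSpan) :=
  L.bracketSpan.mkQ.compAlternatingMap L.trinary

/-- `c_red` is a cocycle; note that `𝔤` acts trivially on `𝔥 / [𝔤, 𝔥]`. -/
theorem cRed_mem : L.cRed ∈ lieCocycles₃ (trivialRep 𝔤 (𝔥 ⧸ L.bracketSpan)) := by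
  intro x y z u
  have key : ∀ (a : 𝔤) (h : 𝔥), L.bracketSpan.mkQ (L.act a h) = 0 := fun a h => by
    rw [Submodule.mkQ_apply, Submodule.Quotient.mk_eq_zero]
    exact Submodule.subset_span ⟨a, h, rfl⟩
  have hc := congrArg L.bracketSpan.mkQ (L.trinary_cocycle x y z u)
  simp only [ceDiff₃, map_add, map_sub, key, map_zero] at hc
  simpa [ceDiff₃, cRed] using hc

/-- The class `[c_red]` in `H³(𝔤, 𝔥 / [𝔤, 𝔥])`. -/
def cRedClass : LieH₃ (trivialRep 𝔤 (𝔥 ⧸ L.bracketSpan)) :=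
  lieClass₃ _ L.cRed L.cRed_mem

/-! ### Third cohomology of the Chevalley-Eilenberg complex `CE(L)`

`CE(L)` is the (positive part of the) graded symmetric algebra `S(𝔥[2] ⊕ 𝔤[1])^*` with
differential `- d₂ + d₃`, where `d₂`, `d₃` are dual to `l₂(x, y) = [x, y]`, `l₂(x, h) = [x, h]`,
`l₃(x, y, z) = -[x, y, z]`, extended by unshuffles. Its components in degrees `2`, `3` and `4` are
`𝔥^* ⊕ ∧²𝔤^*`, `∧³𝔤^* ⊕ (𝔤 ⊗ 𝔥)^*` and `∧⁴𝔤^* ⊕ (∧²𝔤 ⊗ 𝔥)^* ⊕ S²𝔥^*`. -/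

variable (𝔤 𝔥) in
/-- `CE(L)² = 𝔥^* ⊕ ∧²𝔤^*`. -/
abbrev CE₂ : Type _ := (𝔥 →ₗ[ℝ] ℝ) × (𝔤 [⋀^Fin 2]→ₗ[ℝ] ℝ)

variable (𝔤 𝔥) in
/-- `CE(L)³ = ∧³𝔤^* ⊕ (𝔤 ⊗ 𝔥)^*`. -/
def CE₃ : Type _ := (𝔤 [⋀^Fin 3]→ₗ[ℝ] ℝ) × (𝔤 →ₗ[ℝ] 𝔥 →ₗ[ℝ] ℝ)

instance : AddCommGroup (CE₃ 𝔤 𝔥) :=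
  inferInstanceAs (AddCommGroup ((𝔤 [⋀^Fin 3]→ₗ[ℝ] ℝ) × (𝔤 →ₗ[ℝ] 𝔥 →ₗ[ℝ] ℝ)))

instance : Module ℝ (CE₃ 𝔤 𝔥) :=
  inferInstanceAs (Module ℝ ((𝔤 [⋀^Fin 3]→ₗ[ℝ] ℝ) × (𝔤 →ₗ[ℝ] 𝔥 →ₗ[ℝ] ℝ)))

variable (𝔥) in
/-- The inclusion `∧³𝔤^* → CE(L)³`. -/
def CE₃.ofAlt (θ : 𝔤 [⋀^Fin 3]→ₗ[ℝ] ℝ) : CE₃ 𝔤 𝔥 := (θ, 0)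

theorem CE₃.fst_add (a b : CE₃ 𝔤 𝔥) : (a + b).1 = a.1 + b.1 := rfl
theorem CE₃.snd_add (a b : CE₃ 𝔤 𝔥) : (a + b).2 = a.2 + b.2 := rfl
theorem CE₃.fst_zero : (0 : CE₃ 𝔤 𝔥).1 = 0 := rfl
theorem CE₃.snd_zero : (0 : CE₃ 𝔤 𝔥).2 = 0 := rfl
theorem CE₃.fst_smul (r : ℝ) (a : CE₃ 𝔤 𝔥) : (r • a).1 = r • a.1 := rfl
theorem CE₃.snd_smul (r : ℝ) (a : CE₃ 𝔤 𝔥) : (r • a).2 = r • a.2 := rfl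

/-- The component in `∧³𝔤^*` of `d (ξ + φ)`. -/
def d₂g (η : CE₂ 𝔤 𝔥) (x y z : 𝔤) : ℝ :=
  ceDiff₂ (trivialRep 𝔤 ℝ) η.2 x y z - η.1 (L.trinary ![x, y, z])

/-- The component in `(𝔤 ⊗ 𝔥)^*` of `d (ξ + φ)`. -/
def d₂h (η : CE₂ 𝔤 𝔥) (x : 𝔤) (h : 𝔥) : ℝ := -η.1 (L.act x h)

/-- The component in `∧⁴𝔤^*` of `d (θ + B)`. -/
def d₃g (τ : CE₃ 𝔤 𝔥) (x y z u : 𝔤) : ℝ :=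
  ceDiff₃ (trivialRep 𝔤 ℝ) τ.1 x y z u
    + τ.2 x (L.trinary ![y, z, u]) - τ.2 y (L.trinary ![x, z, u])
    + τ.2 z (L.trinary ![x, y, u]) - τ.2 u (L.trinary ![x, y, z])

/-- The component in `(∧²𝔤 ⊗ 𝔥)^*` of `d (θ + B)`. (The one in `S²𝔥^*` is zero, since the unary
bracket of `L` vanishes.) -/
def d₃h (τ : CE₃ 𝔤 𝔥) (x y : 𝔤) (h : 𝔥) : ℝ :=
  τ.2 x (L.act y h) - τ.2 y (L.act x h) - τ.2 ⁅x, y⁆ h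

/-- The `3`-cocycles of `CE(L)`. -/
def ceCocycles₃ : Submodule ℝ (CE₃ 𝔤 𝔥) where
  carrier := {τ | (∀ x y z u, L.d₃g τ x y z u = 0) ∧ ∀ x y h, L.d₃h τ x y h = 0}
  add_mem' := by
    rintro a b ⟨ha, ha'⟩ ⟨hb, hb'⟩
    refine ⟨fun x y z u => ?_, fun x y h => ?_⟩
    · have e : L.d₃g (a + b) x y z u = L.d₃g a x y z u + L.d₃g b x y z u := by
        simp [d₃g, ceDiff₃, CE₃.fst_add, CE₃.snd_add]; ring
      rw [e, ha, hb, add_zero]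
    · have e : L.d₃h (a + b) x y h = L.d₃h a x y h + L.d₃h b x y h := by
        simp [d₃h, CE₃.snd_add]; ring
      rw [e, ha', hb', add_zero]
  zero_mem' := ⟨fun x y z u => by simp [d₃g, ceDiff₃, CE₃.fst_zero, CE₃.snd_zero], fun x y h => by simp [d₃h, CE₃.snd_zero]⟩
  smul_mem' := by
    rintro r a ⟨ha, ha'⟩
    refine ⟨fun x y z u => ?_, fun x y h => ?_⟩
    · have e : L.d₃g (r • a) x y z u = r * L.d₃g a x y z u := by
        simp [d₃g, ceDiff₃, CE₃.fst_smul, CE₃.snd_smul]; ring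
      rw [e, ha, mul_zero]
    · have e : L.d₃h (r • a) x y h = r * L.d₃h a x y h := by
        simp [d₃h, CE₃.snd_smul]; ring
      rw [e, ha', mul_zero]

/-- The `3`-coboundaries of `CE(L)`. -/
def ceCoboundaries₃ : Submodule ℝ (CE₃ 𝔤 𝔥) where
  carrier := {τ | ∃ η : CE₂ 𝔤 𝔥,
    (∀ x y z, τ.1 ![x, y, z] = L.d₂g η x y z) ∧ ∀ x h, τ.2 x h = L.d₂h η x h}
  add_mem' := by
    rintro a b ⟨η, h, h'⟩ ⟨κ, k, k'⟩
    refine ⟨η + κ, fun x y z => ?_, fun x w => ?_⟩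
    · rw [CE₃.fst_add, AlternatingMap.add_apply, h, k]; simp [d₂g, ceDiff₂]; ring
    · rw [CE₃.snd_add, LinearMap.add_apply, LinearMap.add_apply, h', k']; simp [d₂h]; ring
  zero_mem' := ⟨0, fun x y z => by simp [d₂g, ceDiff₂, CE₃.fst_zero], fun x h => by simp [d₂h, CE₃.snd_zero]⟩
  smul_mem' := by
    rintro r a ⟨η, h, h'⟩
    refine ⟨r • η, fun x y z => ?_, fun x w => ?_⟩
    · rw [CE₃.fst_smul, AlternatingMap.smul_apply, h]; simp [d₂g, ceDiff₂]; ring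
    · rw [CE₃.snd_smul, LinearMap.smul_apply, LinearMap.smul_apply, h']; simp [d₂h]

/-- `H³(CE(L))`. -/
abbrev CEH₃ : Type _ := L.ceCocycles₃ ⧸ L.ceCoboundaries₃.comap L.ceCocycles₃.subtype

/-- The class of a cocycle in `H³(CE(L))`. -/
def ceClass₃ (τ : CE₃ 𝔤 𝔥) (hτ : τ ∈ L.ceCocycles₃) : L.CEH₃ := Submodule.Quotient.mk ⟨τ, hτ⟩

end MinimalLie2Algebra

/-! ## Hamiltonian actions and moment maps -/

section MomentMaps

variable {n : ℕ} {M : Type*} [TopologicalSpace M] [ChartedSpace (EuclideanSpace ℝ (Fin n)) M]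
  [IsManifold (𝓡 n) ∞ M]

/-- A Lie algebra morphism `x ↦ v_x` from `𝔤` to the vector fields on `M` (with their usual
bracket) that takes values in Hamiltonian vector fields. -/
structure HamiltonianAction (𝔤 : Type*) [LieRing 𝔤] [LieAlgebra ℝ 𝔤] (Ω : FormField n M 3) where
  v : 𝔤 →ₗ[ℝ] VectorFields n M
  map_lie : ∀ (x y : 𝔤) (m : M), v ⁅x, y⁆ m = VectorField.mlieBracket (𝓡 n) (v x) (v y) m
  hamiltonian : ∀ x : 𝔤, ∃ α ∈ smoothForms n M 1, IsHamiltonianFor Ω α (v x)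

variable {𝔤 𝔥 : Type*} [LieRing 𝔤] [LieAlgebra ℝ 𝔤] [AddCommGroup 𝔥] [Module ℝ 𝔥]
  {Ω : FormField n M 3}

/-- The value at a point of the infinitesimal action, `x ↦ v_x(p)`. -/
def HamiltonianAction.evalAt (A : HamiltonianAction 𝔤 Ω) (p : M) :
    𝔤 →ₗ[ℝ] TangentSpace (𝓡 n) p where
  toFun x := A.v x p
  map_add' x y := by rw [map_add]; rfl
  map_smul' r x := by rw [map_smul]; rfl

/-- `Ω_{3p}(x, y, z) = Ω(v_x, v_y, v_z)|_p`. -/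
def HamiltonianAction.omega₃ (A : HamiltonianAction 𝔤 Ω) (p : M) : 𝔤 [⋀^Fin 3]→ₗ[ℝ] ℝ :=
  (Ω p).toAlternatingMap.compLinearMap (A.evalAt p)

/-- A homotopy moment map for `L = 𝔥[1] ⊕ 𝔤`: an `L_∞`-morphism `(f₁, f₂)` from `L` to the
Lie 2-algebra of observables of `(M, Ω)` such that `d (f₁ x) = - i_{v_x} Ω` for all `x ∈ 𝔤`. -/
structure MomentMap (A : HamiltonianAction 𝔤 Ω) (L : MinimalLie2Algebra 𝔤 𝔥) where
  /-- The component `𝔤 → smoothForms n M 1` of `f₁`; by `moment` it takes values in Hamiltonian forms. -/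
  f₁ : 𝔤 →ₗ[ℝ] smoothForms n M 1
  /-- The component `𝔥 → C^∞(M)` of `f₁`. -/
  f₁h : 𝔥 →ₗ[ℝ] C^∞⟮𝓡 n, M; ℝ⟯
  f₂ : 𝔤 [⋀^Fin 2]→ₗ[ℝ] C^∞⟮𝓡 n, M; ℝ⟯
  /-- `d ∘ f₁ = f₁ ∘ δ` on `𝔥`, with `δ = 0`. -/
  unary : ∀ h : 𝔥, dFun (n := n) (⇑(f₁h h)) = 0
  binary : ∀ x y : 𝔤, dFun (n := n) (⇑(f₂ ![x, y])) =
    (f₁ ⁅x, y⁆ : FormField n M 1) - obsBracket₂ Ω (f₁ x) (f₁ y)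
  /-- `f₁ [h, x] = f₂ (δ h, x)`, with `δ = 0`. -/
  binary_h : ∀ (x : 𝔤) (h : 𝔥), f₁h (L.act x h) = 0
  trinary : ∀ (x y z : 𝔤) (m : M),
    f₁h (L.trinary ![x, y, z]) m - obsBracket₃ Ω (f₁ x) (f₁ y) (f₁ z) m =
      f₂ ![x, ⁅y, z⁆] m - f₂ ![y, ⁅x, z⁆] m + f₂ ![z, ⁅x, y⁆] m
  moment : ∀ x : 𝔤, IsHamiltonianFor Ω (f₁ x) (A.v x)

end MomentMaps

end

/-!
The argument has an algebraic and a geometric half, joined by a primitive of `Ω_{3p}` in `CE(L)`.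

Algebra. As `[c_red] ≠ 0` and `𝔥 / [𝔤, 𝔥]` is finite-dimensional, some linear functional `ξ` on
this quotient has `[ξ ∘ c_red] ≠ 0` in `H³(𝔤)`, and this class spans the one-dimensional space
`H³(𝔤)`. Hence `Ω_{3p} = t ξ ∘ c_red + d_𝔤 φ` for a scalar `t` and a `2`-cochain `φ`. Viewed in
`𝔥^*`, the functional `ξ` vanishes on `[𝔤, 𝔥]`, so its differential in `CE(L)` is just `-ξ ∘ c`,
and `(-t ξ, φ)` is a primitive of `Ω_{3p}` in `CE(L)` (`MinimalLie2Algebra.exists_primitive`).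
That `Ω_{3p}` is a cocycle of `𝔤` at all is `HamiltonianAction.omega₃_mem_lieCocycles₃`.

Geometry. Fix Hamiltonian forms `f x` for `v_x`, linear in `x`. The `1`-forms `f [x, y] - ι_{v_y}
ι_{v_x} Ω` are closed because `d ι_{v_y} ι_{v_x} Ω = -ι_{[v_x, v_y]} Ω`
(`FormField.d_interior_interior`). If `H¹(M) = 0` they have primitives `f₂(x, y)`, which can be
chosen alternating and equal to `φ(x, y)` at `p`. With the functional of the primitive of
`Ω_{3p}`, valued in constant functions, as the component on `𝔥`, the two sides of the trinary
equation have equal differentials by `FormField.mfderiv_apply₃_eq` and the Jacobi identity. At `p`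
the equation says that `(-t ξ, φ)` is a primitive of `Ω_{3p}`; as `M` is connected it holds
everywhere (`HamiltonianAction.nonempty_momentMap`).

The Cartan calculus is done at the centre of a chart, in the model space, where everything is
linear algebra in the first derivatives of `Ω` and of the vector fields; the one fact needing a
whole neighbourhood is `d² = 0`, for which `FormField.inChart_d` shows that `d` does not depend on
the chart.
-/

noncomputable section

/-! ### Alternating maps in two and three arguments -/

section AlternatingThree

variable {R N V : Type*} [CommRing R] [AddCommGroup N] [Module R N] [AddCommGroup V] [Module R V]

theorem AlternatingMap.map_swap_two (φ : N [⋀^Fin 2]→ₗ[R] V) (u v : N) :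
    φ ![u, v] = -φ ![v, u] := by
  have e : ![v, u] ∘ Equiv.swap (0 : Fin 2) 1 = ![u, v] := by
    funext i; fin_cases i <;> simp
  rw [← e, φ.map_swap _ (by decide)]

theorem AlternatingMap.map_swap₀₁ (θ : N [⋀^Fin 3]→ₗ[R] V) (u v w : N) :
    θ ![u, v, w] = -θ ![v, u, w] := by
  have e : ![v, u, w] ∘ Equiv.swap (0 : Fin 3) 1 = ![u, v, w] := by
    funext i; fin_cases i <;> simp [Equiv.swap_apply_of_ne_of_ne]
  rw [← e, θ.map_swap _ (by decide)]

theorem AlternatingMap.map_swap₁₂ (θ : N [⋀^Fin 3]→ₗ[R] V) (u v w : N) :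
    θ ![u, v, w] = -θ ![u, w, v] := by
  have e : ![u, w, v] ∘ Equiv.swap (1 : Fin 3) 2 = ![u, v, w] := by
    funext i; fin_cases i <;> simp [Equiv.swap_apply_of_ne_of_ne]
  rw [← e, θ.map_swap _ (by decide)]

theorem AlternatingMap.map_neg₀ (θ : N [⋀^Fin 3]→ₗ[R] V) (u v w : N) :
    θ ![-u, v, w] = -θ ![u, v, w] := by
  have e : ∀ t, Function.update ![u, v, w] 0 t = ![t, v, w] := fun t => by
    funext i; fin_cases i <;> simp
  rw [← e, θ.map_update_neg, e]

end AlternatingThree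

/-! ### Cartan calculus for closed 3-forms on a normed space -/

section FlatCartan

open ContinuousAlternatingMap

variable {E : Type*} [NormedAddCommGroup E] [NormedSpace ℝ E]

theorem alt₃_swap₀₁ (θ : E [⋀^Fin 3]→L[ℝ] ℝ) (u v w : E) : θ ![u, v, w] = -θ ![v, u, w] :=
  θ.toAlternatingMap.map_swap₀₁ u v w

theorem alt₃_swap₁₂ (θ : E [⋀^Fin 3]→L[ℝ] ℝ) (u v w : E) : θ ![u, v, w] = -θ ![u, w, v] :=
  θ.toAlternatingMap.map_swap₁₂ u v w

theorem alt₃_rotate (θ : E [⋀^Fin 3]→L[ℝ] ℝ) (u v w : E) : θ ![u, v, w] = θ ![v, w, u] := by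
  rw [alt₃_swap₀₁, alt₃_swap₁₂, neg_neg]

theorem alt₃_sub₀ (θ : E [⋀^Fin 3]→L[ℝ] ℝ) (u u' v w : E) :
    θ ![u - u', v, w] = θ ![u, v, w] - θ ![u', v, w] := by
  simp only [← curryLeft_apply_apply θ, map_sub, ContinuousAlternatingMap.sub_apply]

theorem alt₃_sub₁ (θ : E [⋀^Fin 3]→L[ℝ] ℝ) (u v v' w : E) :
    θ ![u, v - v', w] = θ ![u, v, w] - θ ![u, v', w] := by
  simp only [alt₃_rotate θ u, alt₃_sub₀]

theorem alt₃_sub₂ (θ : E [⋀^Fin 3]→L[ℝ] ℝ) (u v w w' : E) :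
    θ ![u, v, w - w'] = θ ![u, v, w] - θ ![u, v, w'] := by
  simp only [alt₃_rotate θ u, alt₃_sub₁]

/-- Leibniz rule for the contraction `y ↦ ι_{X y} (θ y)`. -/
theorem hasFDerivAt_curryLeft {k : ℕ} {θ : E → E [⋀^Fin (k + 1)]→L[ℝ] ℝ} {X : E → E} {a : E}
    (hθ : DifferentiableAt ℝ θ a) (hX : DifferentiableAt ℝ X a) :
    HasFDerivAt (fun y => (θ y).curryLeft (X y))
      ((θ a).curryLeft ∘L fderiv ℝ X a +
        (((curryLeftLI (𝕜 := ℝ) (E := E) (F := ℝ)).toContinuousLinearMap ∘L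
          fderiv ℝ θ a).flip (X a))) a := by
  have h := (curryLeftLI (𝕜 := ℝ) (E := E) (F := ℝ) (n := k)).toContinuousLinearMap.hasFDerivAt
    (x := θ a)
  have hc : HasFDerivAt (fun y => (θ y).curryLeft) _ a :=
    HasFDerivAt.comp (𝕜 := ℝ) (F := E [⋀^Fin (k + 1)]→L[ℝ] ℝ)
      (G := E →L[ℝ] E [⋀^Fin k]→L[ℝ] ℝ) (f := θ) a h hθ.hasFDerivAt
  exact hc.clm_apply hX.hasFDerivAt

theorem fderiv_curryLeft_apply {k : ℕ} {θ : E → E [⋀^Fin (k + 1)]→L[ℝ] ℝ} {X : E → E} {a : E}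
    (hθ : DifferentiableAt ℝ θ a) (hX : DifferentiableAt ℝ X a) (u : E) (v : Fin k → E) :
    fderiv ℝ (fun y => (θ y).curryLeft (X y)) a u v =
      θ a (Matrix.vecCons (fderiv ℝ X a u) v) + fderiv ℝ θ a u (Matrix.vecCons (X a) v) := by
  rw [(hasFDerivAt_curryLeft hθ hX).fderiv]
  rfl

theorem extDeriv_one_apply (β : E → E [⋀^Fin 1]→L[ℝ] ℝ) (a u v : E) :
    extDeriv β a ![u, v] = fderiv ℝ β a u ![v] - fderiv ℝ β a v ![u] := by
  have h0 : (0 : Fin 2).removeNth ![u, v] = ![v] := by ext i; fin_cases i; rfl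
  have h1 : (1 : Fin 2).removeNth ![u, v] = ![u] := by ext i; fin_cases i; rfl
  rw [extDeriv, alternatizeUncurryFin_apply]
  simp [Fin.sum_univ_succ, h0, h1]
  ring

theorem extDeriv_two_apply (β : E → E [⋀^Fin 2]→L[ℝ] ℝ) (a u v w : E) :
    extDeriv β a ![u, v, w] =
      fderiv ℝ β a u ![v, w] - fderiv ℝ β a v ![u, w] + fderiv ℝ β a w ![u, v] := by
  have h0 : (0 : Fin 3).removeNth ![u, v, w] = ![v, w] := by funext i; fin_cases i <;> rfl
  have h1 : (1 : Fin 3).removeNth ![u, v, w] = ![u, w] := by funext i; fin_cases i <;> rfl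
  have h2 : (2 : Fin 3).removeNth ![u, v, w] = ![u, v] := by funext i; fin_cases i <;> rfl
  rw [extDeriv, alternatizeUncurryFin_apply]
  simp [Fin.sum_univ_three, h0, h1, h2]
  ring

theorem extDeriv_three_apply (θ : E → E [⋀^Fin 3]→L[ℝ] ℝ) (a u v w z : E) :
    extDeriv θ a ![u, v, w, z] =
      fderiv ℝ θ a u ![v, w, z] - fderiv ℝ θ a v ![u, w, z] + fderiv ℝ θ a w ![u, v, z]
        - fderiv ℝ θ a z ![u, v, w] := by
  have h0 : (0 : Fin 4).removeNth ![u, v, w, z] = ![v, w, z] := by funext i; fin_cases i <;> rfl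
  have h1 : (1 : Fin 4).removeNth ![u, v, w, z] = ![u, w, z] := by funext i; fin_cases i <;> rfl
  have h2 : (2 : Fin 4).removeNth ![u, v, w, z] = ![u, v, z] := by funext i; fin_cases i <;> rfl
  have h3 : (3 : Fin 4).removeNth ![u, v, w, z] = ![u, v, w] := by funext i; fin_cases i <;> rfl
  rw [extDeriv, alternatizeUncurryFin_apply]
  simp [Fin.sum_univ_four, h0, h1, h2, h3, pow_succ]
  ring

variable {θ : E → E [⋀^Fin 3]→L[ℝ] ℝ} {X Y Z : E → E} {a : E}

/-- If `dθ = 0` and `d(ι_X θ) = 0` at `a`, then the Lie derivative `L_X θ = d ι_X θ + ι_X dθ`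
vanishes at `a`; the left-hand side is `(L_X θ)(u, v, w)` written out with constant fields `u`,
`v`, `w`. -/
theorem lieDeriv_eq_zero (hθ : DifferentiableAt ℝ θ a) (hX : DifferentiableAt ℝ X a)
    (dθ : extDeriv θ a = 0) (dX : extDeriv (fun y => (θ y).curryLeft (X y)) a = 0) (u v w : E) :
    fderiv ℝ θ a (X a) ![u, v, w] + θ a ![fderiv ℝ X a u, v, w] + θ a ![u, fderiv ℝ X a v, w]
      + θ a ![u, v, fderiv ℝ X a w] = 0 := by
  have h1 := extDeriv_three_apply θ a (X a) u v w
  have h2 := extDeriv_two_apply (fun y => (θ y).curryLeft (X y)) a u v w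
  rw [dθ] at h1
  rw [dX, fderiv_curryLeft_apply hθ hX, fderiv_curryLeft_apply hθ hX,
    fderiv_curryLeft_apply hθ hX] at h2
  simp only [ContinuousAlternatingMap.coe_zero, Pi.zero_apply] at h1 h2
  linarith [alt₃_swap₀₁ (θ a) u (fderiv ℝ X a v) w, alt₃_swap₁₂ (θ a) u v (fderiv ℝ X a w),
    alt₃_swap₀₁ (θ a) u (fderiv ℝ X a w) v]

/-- `d ι_Y ι_X θ = -ι_{[X, Y]} θ` when `θ`, `ι_X θ` and `ι_Y θ` are closed: since `L_Y θ = 0` and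
`ι_X θ` is closed, `d ι_Y ι_X θ = L_Y ι_X θ = ι_{[Y, X]} θ`. -/
theorem extDeriv_interior_interior (hθ : DifferentiableAt ℝ θ a) (hX : DifferentiableAt ℝ X a)
    (hY : DifferentiableAt ℝ Y a) (dθ : extDeriv θ a = 0)
    (dX : extDeriv (fun y => (θ y).curryLeft (X y)) a = 0)
    (dY : extDeriv (fun y => (θ y).curryLeft (Y y)) a = 0) :
    extDeriv (fun y => ((θ y).curryLeft (X y)).curryLeft (Y y)) a =
      -(θ a).curryLeft (VectorField.lieBracket ℝ X Y a) := by
  ext s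
  obtain ⟨u, v, rfl⟩ : ∃ u v, s = ![u, v] := ⟨s 0, s 1, by ext i; fin_cases i <;> rfl⟩
  have hβ : DifferentiableAt ℝ (fun y => (θ y).curryLeft (X y)) a :=
    (hasFDerivAt_curryLeft hθ hX).differentiableAt
  have h1 := extDeriv_two_apply (fun y => (θ y).curryLeft (X y)) a (Y a) u v
  have h2 := lieDeriv_eq_zero hθ hY dθ dY (X a) u v
  rw [dX] at h1
  rw [extDeriv_one_apply, fderiv_curryLeft_apply hβ hY, fderiv_curryLeft_apply hβ hY]
  simp only [fderiv_curryLeft_apply hθ hX, ContinuousAlternatingMap.coe_zero, Pi.zero_apply,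
    curryLeft_apply_apply, ContinuousAlternatingMap.neg_apply, VectorField.lieBracket] at h1 h2 ⊢
  rw [alt₃_sub₀]
  linarith [alt₃_swap₁₂ (θ a) (X a) u (fderiv ℝ Y a v)]

theorem differentiableAt_alt₃_apply (hθ : DifferentiableAt ℝ θ a) (hX : DifferentiableAt ℝ X a)
    (hY : DifferentiableAt ℝ Y a) (hZ : DifferentiableAt ℝ Z a) :
    DifferentiableAt ℝ (fun y => θ y ![X y, Y y, Z y]) a := by
  have hX' := (hasFDerivAt_curryLeft hθ hX).differentiableAt
  have hY' := (hasFDerivAt_curryLeft hX' hY).differentiableAt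
  have hZ' := (hasFDerivAt_curryLeft hY' hZ).differentiableAt
  exact ((apply ℝ E ℝ (![] : Fin 0 → E)).hasFDerivAt.comp a hZ'.hasFDerivAt).differentiableAt

theorem fderiv_alt₃_apply (hθ : DifferentiableAt ℝ θ a) (hX : DifferentiableAt ℝ X a)
    (hY : DifferentiableAt ℝ Y a) (hZ : DifferentiableAt ℝ Z a) (w : E) :
    fderiv ℝ (fun y => θ y ![X y, Y y, Z y]) a w =
      fderiv ℝ θ a w ![X a, Y a, Z a] + θ a ![fderiv ℝ X a w, Y a, Z a]
        + θ a ![X a, fderiv ℝ Y a w, Z a] + θ a ![X a, Y a, fderiv ℝ Z a w] := by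
  have hX' := (hasFDerivAt_curryLeft hθ hX).differentiableAt
  have hY' := (hasFDerivAt_curryLeft hX' hY).differentiableAt
  have hZ' := (hasFDerivAt_curryLeft hY' hZ).differentiableAt
  have e : (fun y => θ y ![X y, Y y, Z y]) =
      fun y => apply ℝ E ℝ (![] : Fin 0 → E)
        ((((θ y).curryLeft (X y)).curryLeft (Y y)).curryLeft (Z y)) := rfl
  have hc := ((apply ℝ E ℝ (![] : Fin 0 → E)).hasFDerivAt.comp a hZ'.hasFDerivAt).fderiv
  rw [e]
  refine (DFunLike.congr_fun hc w).trans ?_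
  change fderiv ℝ (fun y => (((θ y).curryLeft (X y)).curryLeft (Y y)).curryLeft (Z y)) a w ![] = _
  rw [fderiv_curryLeft_apply hY' hZ, fderiv_curryLeft_apply hX' hY, fderiv_curryLeft_apply hθ hX]
  simp only [curryLeft_apply_apply]
  ring

/-- The differential of `θ(X, Y, Z)` when `θ` and its contractions with `X`, `Y` and `Z` are
closed. The equation `dθ(w, X, Y, Z) = 0` expresses `(∂_w θ)(X, Y, Z)` through derivatives of `θ`
along `X`, `Y`, `Z`, and these are eliminated by `L_X θ = L_Y θ = L_Z θ = 0`. -/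
theorem fderiv_alt₃_eq (hθ : DifferentiableAt ℝ θ a) (hX : DifferentiableAt ℝ X a)
    (hY : DifferentiableAt ℝ Y a) (hZ : DifferentiableAt ℝ Z a) (dθ : extDeriv θ a = 0)
    (dX : extDeriv (fun y => (θ y).curryLeft (X y)) a = 0)
    (dY : extDeriv (fun y => (θ y).curryLeft (Y y)) a = 0)
    (dZ : extDeriv (fun y => (θ y).curryLeft (Z y)) a = 0) (w : E) :
    fderiv ℝ (fun y => θ y ![X y, Y y, Z y]) a w =
      -θ a ![X a, VectorField.lieBracket ℝ Y Z a, w]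
        + θ a ![Y a, VectorField.lieBracket ℝ X Z a, w]
        - θ a ![Z a, VectorField.lieBracket ℝ X Y a, w] := by
  have hw := fderiv_alt₃_apply hθ hX hY hZ w
  have d := extDeriv_three_apply θ a w (X a) (Y a) (Z a)
  have kX := lieDeriv_eq_zero hθ hX dθ dX w (Y a) (Z a)
  have kY := lieDeriv_eq_zero hθ hY dθ dY w (X a) (Z a)
  have kZ := lieDeriv_eq_zero hθ hZ dθ dZ w (X a) (Y a)
  rw [dθ, ContinuousAlternatingMap.coe_zero, Pi.zero_apply] at d
  simp only [VectorField.lieBracket, alt₃_sub₁]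
  linarith [alt₃_swap₀₁ (θ a) (X a) (fderiv ℝ Y a w) (Z a),
    alt₃_swap₁₂ (θ a) (X a) (Y a) (fderiv ℝ Z a w),
    alt₃_swap₀₁ (θ a) (X a) (fderiv ℝ Z a w) (Y a),
    alt₃_rotate (θ a) w (X a) (fderiv ℝ Y a (Z a)), alt₃_rotate (θ a) w (X a) (fderiv ℝ Z a (Y a)),
    alt₃_rotate (θ a) w (Y a) (fderiv ℝ X a (Z a)), alt₃_rotate (θ a) w (Y a) (fderiv ℝ Z a (X a)),
    alt₃_rotate (θ a) w (Z a) (fderiv ℝ X a (Y a)), alt₃_rotate (θ a) w (Z a) (fderiv ℝ Y a (X a)),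
    alt₃_swap₁₂ (θ a) w (fderiv ℝ X a (Y a)) (Z a), alt₃_swap₁₂ (θ a) w (fderiv ℝ Y a (X a)) (Z a),
    alt₃_swap₁₂ (θ a) w (fderiv ℝ Z a (X a)) (Y a)]

/-- The Leibniz rule `W(θ(X, Y, Z)) = θ([W, X], Y, Z) + θ(X, [W, Y], Z) + θ(X, Y, [W, Z])` for a
field `W` with `L_W θ = 0`; nothing is required of `X`, `Y`, `Z` beyond differentiability. -/
theorem fderiv_alt₃_of_invariant (hθ : DifferentiableAt ℝ θ a) (hX : DifferentiableAt ℝ X a)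
    (hY : DifferentiableAt ℝ Y a) (hZ : DifferentiableAt ℝ Z a) {W : E → E}
    (hW : DifferentiableAt ℝ W a) (dθ : extDeriv θ a = 0)
    (dW : extDeriv (fun y => (θ y).curryLeft (W y)) a = 0) :
    fderiv ℝ (fun y => θ y ![X y, Y y, Z y]) a (W a) =
      θ a ![VectorField.lieBracket ℝ W X a, Y a, Z a]
        + θ a ![X a, VectorField.lieBracket ℝ W Y a, Z a]
        + θ a ![X a, Y a, VectorField.lieBracket ℝ W Z a] := by
  have k := lieDeriv_eq_zero hθ hW dθ dW (X a) (Y a) (Z a)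
  rw [fderiv_alt₃_apply hθ hX hY hZ]
  simp only [VectorField.lieBracket, alt₃_sub₀, alt₃_sub₁, alt₃_sub₂]
  linarith

end FlatCartan

/-! ### Forms and vector fields in charts -/

section Charts

open ContinuousAlternatingMap

variable {n : ℕ} {M : Type*} [TopologicalSpace M] [ChartedSpace (EuclideanSpace ℝ (Fin n)) M]

/-- The expression of a vector field in the preferred chart `φ` at `m₀`: the pullback
`(φ⁻¹)^* X`. -/
def vfInChart (X : (m : M) → TangentSpace (𝓡 n) m) (m₀ : M) :
    EuclideanSpace ℝ (Fin n) → EuclideanSpace ℝ (Fin n) :=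
  VectorField.mpullback 𝓘(ℝ, EuclideanSpace ℝ (Fin n)) (𝓡 n) (extChartAt (𝓡 n) m₀).symm X

theorem FormField.contDiffAt_inChart {k : ℕ} {α : FormField n M k}
    (hα : α ∈ smoothForms n M k) (m : M) :
    ContDiffAt ℝ ∞ (α.inChart m) (extChartAt (𝓡 n) m m) :=
  (hα m).contDiffAt (extChartAt_target_mem_nhds m)

theorem FormField.differentiableAt_inChart {k : ℕ} {α : FormField n M k}
    (hα : α ∈ smoothForms n M k) (m : M) :
    DifferentiableAt ℝ (α.inChart m) (extChartAt (𝓡 n) m m) :=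
  (FormField.contDiffAt_inChart hα m).differentiableAt (by simp)

theorem FormField.d_add {k : ℕ} {α β : FormField n M k} (hα : α ∈ smoothForms n M k)
    (hβ : β ∈ smoothForms n M k) : (α + β).d = α.d + β.d := by
  funext m
  ext u
  exact DFunLike.congr_fun
    (extDeriv_add (FormField.differentiableAt_inChart hα m)
      (FormField.differentiableAt_inChart hβ m)) _

theorem FormField.d_smul {k : ℕ} (r : ℝ) (α : FormField n M k) : (r • α).d = r • α.d := by
  funext m
  ext u
  exact DFunLike.congr_fun (extDeriv_smul r (α.inChart m)) _

theorem FormField.d_sub {k : ℕ} {α β : FormField n M k} (hα : α ∈ smoothForms n M k)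
    (hβ : β ∈ smoothForms n M k) : (α - β).d = α.d - β.d := by
  have h : α - β = α + (-1 : ℝ) • β := by module
  rw [h, FormField.d_add hα ((smoothForms n M k).smul_mem _ hβ), FormField.d_smul]
  module

theorem FormField.interior_add_left {k : ℕ} (X Y : (m : M) → TangentSpace (𝓡 n) m)
    (α : FormField n M (k + 1)) :
    FormField.interior (X + Y) α = FormField.interior X α + FormField.interior Y α :=
  funext fun m => map_add (ContinuousAlternatingMap.curryLeft (𝕜 := ℝ)
    (E := EuclideanSpace ℝ (Fin n)) (F := ℝ) (α m)) (X m) (Y m)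

theorem FormField.interior_smul_left {k : ℕ} (r : ℝ) (X : (m : M) → TangentSpace (𝓡 n) m)
    (α : FormField n M (k + 1)) :
    FormField.interior (r • X) α = r • FormField.interior X α :=
  funext fun m => map_smul (ContinuousAlternatingMap.curryLeft (𝕜 := ℝ)
    (E := EuclideanSpace ℝ (Fin n)) (F := ℝ) (α m)) r (X m)

theorem FormField.interior_add_right {k : ℕ} (X : (m : M) → TangentSpace (𝓡 n) m)
    (α β : FormField n M (k + 1)) :
    FormField.interior X (α + β) = FormField.interior X α + FormField.interior X β := rfl

theorem FormField.interior_smul_right {k : ℕ} (r : ℝ) (X : (m : M) → TangentSpace (𝓡 n) m)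
    (α : FormField n M (k + 1)) :
    FormField.interior X (r • α) = r • FormField.interior X α := rfl

theorem FormField.interior_interior_self {k : ℕ} (X : (m : M) → TangentSpace (𝓡 n) m)
    (α : FormField n M (k + 2)) : FormField.interior X (FormField.interior X α) = 0 :=
  funext fun m => ContinuousAlternatingMap.curryLeft_same (𝕜 := ℝ)
    (E := EuclideanSpace ℝ (Fin n)) (F := ℝ) (α m) (X m)

theorem mdifferentiable_smooth (f : C^∞⟮𝓡 n, M; ℝ⟯) (m : M) :
    MDifferentiableAt (𝓡 n) 𝓘(ℝ, ℝ) f m :=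
  f.contMDiff.mdifferentiableAt (by simp)

variable (n M) in
/-- The differential of smooth functions, as a linear map. -/
def dFunₗ : C^∞⟮𝓡 n, M; ℝ⟯ →ₗ[ℝ] FormField n M 1 where
  toFun f := dFun (n := n) ⇑f
  map_add' f g := by
    funext m
    ext u
    exact DFunLike.congr_fun
      (mfderiv_add (mdifferentiable_smooth f m) (mdifferentiable_smooth g m)) (u 0)
  map_smul' r f := by
    funext m
    ext u
    exact DFunLike.congr_fun (const_smul_mfderiv (mdifferentiable_smooth f m) r) (u 0)

theorem dFun_const (c : ℝ) : dFunₗ n M (algebraMap ℝ C^∞⟮𝓡 n, M; ℝ⟯ c) = 0 := by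
  funext m
  ext u
  exact DFunLike.congr_fun (mfderiv_const (I := 𝓡 n) (I' := 𝓘(ℝ, ℝ)) (x := m) (c := c)) (u 0)

theorem mfderiv_eq_of_dFun_eq {f : C^∞⟮𝓡 n, M; ℝ⟯} {β : FormField n M 1} (h : dFunₗ n M f = β)
    (m : M) (w : TangentSpace (𝓡 n) m) :
    mfderiv (𝓡 n) 𝓘(ℝ, ℝ) f m w = β m ![w] := by
  subst h; rfl

variable [IsManifold (𝓡 n) ∞ M]

theorem isInvertible_mfderiv_extChartAt_symm (m₀ : M) {y : EuclideanSpace ℝ (Fin n)}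
    (hy : y ∈ (extChartAt (𝓡 n) m₀).target) :
    (mfderiv 𝓘(ℝ, EuclideanSpace ℝ (Fin n)) (𝓡 n) (extChartAt (𝓡 n) m₀).symm y).IsInvertible := by
  have : IsManifold (𝓡 n) 1 M := .of_le (n := ∞) (by simp)
  have := isInvertible_mfderivWithin_extChartAt_symm hy
  rwa [ModelWithCorners.range_eq_univ, mfderivWithin_univ] at this

theorem FormField.inChart_interior {k : ℕ} (X : (m : M) → TangentSpace (𝓡 n) m)
    (α : FormField n M (k + 1)) (m₀ : M) {y : EuclideanSpace ℝ (Fin n)}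
    (hy : y ∈ (extChartAt (𝓡 n) m₀).target) :
    (FormField.interior X α).inChart m₀ y = (α.inChart m₀ y).curryLeft (vfInChart X m₀ y) := by
  have h := (isInvertible_mfderiv_extChartAt_symm m₀ hy).self_apply_inverse
    (X ((extChartAt (𝓡 n) m₀).symm y))
  ext u
  refine congrArg (α ((extChartAt (𝓡 n) m₀).symm y)) (funext fun i => ?_)
  refine Fin.cases ?_ (fun j => ?_) i
  · exact h.symm
  · rfl

theorem contDiffOn_vfInChart (X : VectorFields n M) (m₀ : M) :
    ContDiffOn ℝ ∞ (vfInChart (⇑X) m₀) (extChartAt (𝓡 n) m₀).target := by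
  intro y hy
  have : IsManifold (𝓡 n) 1 M := .of_le (n := ∞) (by simp)
  have h1 : ContMDiffAt 𝓘(ℝ, EuclideanSpace ℝ (Fin n)) (𝓡 n) ∞ (extChartAt (𝓡 n) m₀).symm y :=
    (contMDiffOn_extChartAt_symm m₀).contMDiffAt ((isOpen_extChartAt_target m₀).mem_nhds hy)
  have h2 := ContMDiffAt.mpullback_vectorField_preimage (X.contMDiff _) h1
    (isInvertible_mfderiv_extChartAt_symm m₀ hy) (by simp)
  exact (contMDiffAt_vectorSpace_iff_contDiffAt.1 h2).contDiffWithinAt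

theorem mfderiv_symm_mfderiv_extChartAt (m₀ : M) {m : M} (hm : m ∈ (extChartAt (𝓡 n) m₀).source)
    (u : TangentSpace (𝓡 n) m) :
    mfderiv 𝓘(ℝ, EuclideanSpace ℝ (Fin n)) (𝓡 n) (extChartAt (𝓡 n) m₀).symm
      (extChartAt (𝓡 n) m₀ m)
      (mfderiv (𝓡 n) 𝓘(ℝ, EuclideanSpace ℝ (Fin n)) (extChartAt (𝓡 n) m₀) m u) = u := by
  have : IsManifold (𝓡 n) 1 M := .of_le (n := ∞) (by simp)
  have h := mfderivWithin_extChartAt_symm_comp_mfderiv_extChartAt' hm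
  rw [ModelWithCorners.range_eq_univ, mfderivWithin_univ] at h
  exact DFunLike.congr_fun h u

/-- A form is recovered from its expression `(φ⁻¹)^* α` in a chart by pulling back along `φ`. -/
theorem FormField.apply_eq_inChart {k : ℕ} (α : FormField n M k) (m₀ : M) {m : M}
    (hm : m ∈ (extChartAt (𝓡 n) m₀).source) (u : Fin k → TangentSpace (𝓡 n) m) :
    α m u = α.inChart m₀ (extChartAt (𝓡 n) m₀ m) fun i =>
      mfderiv (𝓡 n) 𝓘(ℝ, EuclideanSpace ℝ (Fin n)) (extChartAt (𝓡 n) m₀) m (u i) := by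
  -- `φ.symm (φ m)` equals `m` only propositionally, so the base point is changed in the model space
  have e : ∀ q : M, q = m → ∀ w : Fin k → EuclideanSpace ℝ (Fin n), α q w = α m w := by
    rintro q rfl w; rfl
  refine .symm ((e _ ((extChartAt (𝓡 n) m₀).left_inv hm) _).trans ?_)
  exact congrArg (α m) (funext fun i => mfderiv_symm_mfderiv_extChartAt m₀ hm (u i))

theorem vfInChart_extChartAt (X : (m : M) → TangentSpace (𝓡 n) m) (m₀ : M) {m : M}
    (hm : m ∈ (extChartAt (𝓡 n) m₀).source) :
    vfInChart X m₀ (extChartAt (𝓡 n) m₀ m) =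
      mfderiv (𝓡 n) 𝓘(ℝ, EuclideanSpace ℝ (Fin n)) (extChartAt (𝓡 n) m₀) m (X m) := by
  have hT := isInvertible_mfderiv_extChartAt_symm m₀ ((extChartAt (𝓡 n) m₀).map_source hm)
  refine hT.inverse_apply_eq.2 ?_
  have e : ∀ q : M, q = m → (X q : EuclideanSpace ℝ (Fin n)) = X m := by rintro q rfl; rfl
  exact (e _ ((extChartAt (𝓡 n) m₀).left_inv hm)).trans
    (mfderiv_symm_mfderiv_extChartAt m₀ hm (X m)).symm

/-- At the centre of the chart the manifold bracket is carried to the bracket of the local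
expressions. -/
theorem mfderiv_mlieBracket (X Y : (m : M) → TangentSpace (𝓡 n) m) (m : M) :
    mfderiv (𝓡 n) 𝓘(ℝ, EuclideanSpace ℝ (Fin n)) (extChartAt (𝓡 n) m) m
        (VectorField.mlieBracket (𝓡 n) X Y m) =
      VectorField.lieBracket ℝ (vfInChart X m) (vfInChart Y m) (extChartAt (𝓡 n) m m) := by
  have : IsManifold (𝓡 n) 1 M := .of_le (n := ∞) (by simp)
  have hφ := isInvertible_mfderiv_extChartAt (I := 𝓡 n) (mem_extChartAt_source (I := 𝓡 n) m)
  rw [← VectorField.mlieBracketWithin_univ, VectorField.mlieBracketWithin_apply]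
  simp only [Set.preimage_univ, ModelWithCorners.range_eq_univ, Set.univ_inter,
    VectorField.mpullbackWithin_univ]
  exact (hφ.self_apply_inverse _).trans (congrFun
    (VectorField.lieBracketWithin_univ (𝕜 := ℝ) (E := EuclideanSpace ℝ (Fin n))
      (V := vfInChart X m) (W := vfInChart Y m)) _)

theorem minSmoothness_two_le_infty : minSmoothness ℝ 2 ≤ (∞ : WithTop ℕ∞) := by
  rw [minSmoothness_of_isRCLikeNormedField]
  exact WithTop.coe_le_coe.2 (le_top : (2 : ℕ∞) ≤ ⊤)

/-- The exterior derivative, defined at each point in the preferred chart of that point, is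
computed by any chart throughout its domain. This is the naturality of `extDeriv` under the
transition map `ψ`. -/
theorem FormField.inChart_d {k : ℕ} {α : FormField n M k} (hα : α ∈ smoothForms n M k) (m₀ : M)
    {y : EuclideanSpace ℝ (Fin n)} (hy : y ∈ (extChartAt (𝓡 n) m₀).target) :
    α.d.inChart m₀ y = extDeriv (α.inChart m₀) y := by
  have : IsManifold (𝓡 n) 1 M := .of_le (n := ∞) (by simp)
  set q := (extChartAt (𝓡 n) m₀).symm y with hq
  -- the transition map from the chart at `m₀` to the preferred chart at `q`
  set ψ : EuclideanSpace ℝ (Fin n) → EuclideanSpace ℝ (Fin n) :=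
    extChartAt (𝓡 n) q ∘ (extChartAt (𝓡 n) m₀).symm with hψ
  have hsymm : ∀ z ∈ (extChartAt (𝓡 n) m₀).target,
      ContMDiffAt 𝓘(ℝ, EuclideanSpace ℝ (Fin n)) (𝓡 n) ∞ (extChartAt (𝓡 n) m₀).symm z :=
    fun z hz => (contMDiffOn_extChartAt_symm m₀).contMDiffAt
      ((isOpen_extChartAt_target m₀).mem_nhds hz)
  have hchart : ∀ m ∈ (extChartAt (𝓡 n) q).source,
      ContMDiffAt (𝓡 n) 𝓘(ℝ, EuclideanSpace ℝ (Fin n)) ∞ (extChartAt (𝓡 n) q) m :=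
    fun m hm => contMDiffAt_extChartAt' (by rwa [← extChartAt_source (𝓡 n)])
  have hfd : ∀ z ∈ (extChartAt (𝓡 n) m₀).target,
      (extChartAt (𝓡 n) m₀).symm z ∈ (extChartAt (𝓡 n) q).source → ∀ u,
      fderiv ℝ ψ z u = mfderiv (𝓡 n) 𝓘(ℝ, EuclideanSpace ℝ (Fin n)) (extChartAt (𝓡 n) q)
        ((extChartAt (𝓡 n) m₀).symm z) (mfderiv 𝓘(ℝ, EuclideanSpace ℝ (Fin n)) (𝓡 n)
          (extChartAt (𝓡 n) m₀).symm z u) := by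
    intro z hz hz' u
    rw [← mfderiv_eq_fderiv, hψ, mfderiv_comp z ((hchart _ hz').mdifferentiableAt (by simp))
      ((hsymm z hz).mdifferentiableAt (by simp))]
    rfl
  have hyq : q ∈ (extChartAt (𝓡 n) q).source := mem_extChartAt_source q
  have hψs : ContDiffAt ℝ ∞ ψ y :=
    (ContMDiffAt.comp y (hchart _ hyq) (hsymm y hy)).contDiffAt
  have hloc : α.inChart m₀ =ᶠ[nhds y] fun z =>
      (α.inChart q (ψ z)).compContinuousLinearMap (fderiv ℝ ψ z) := by
    have hc : ContinuousAt (extChartAt (𝓡 n) m₀).symm y := (hsymm y hy).continuousAt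
    filter_upwards [(isOpen_extChartAt_target m₀).mem_nhds hy,
      hc.preimage_mem_nhds (extChartAt_source_mem_nhds (I := 𝓡 n) q)] with z hz hz'
    ext u
    refine (FormField.apply_eq_inChart α q hz' _).trans ?_
    exact congrArg (α.inChart q (ψ z)) (funext fun i => (hfd z hz hz' (u i)).symm)
  have hd : DifferentiableAt ℝ (α.inChart q) (ψ y) :=
    ((hα q).contDiffAt (extChartAt_target_mem_nhds q)).differentiableAt (by simp)
  rw [hloc.extDeriv_eq, extDeriv_pullback hd hψs minSmoothness_two_le_infty]
  ext u
  exact congrArg (extDeriv (α.inChart q) (ψ y)) (funext fun i => (hfd y hy hyq (u i)).symm)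

/-- Closedness can be tested at the centres of the preferred charts, where the chart derivative is
invertible. -/
theorem FormField.d_eq_zero_iff {k : ℕ} (α : FormField n M k) :
    α.d = 0 ↔ ∀ m : M, extDeriv (α.inChart m) (extChartAt (𝓡 n) m m) = 0 := by
  have : IsManifold (𝓡 n) 1 M := .of_le (n := ∞) (by simp)
  constructor
  · intro h m
    have hφ := isInvertible_mfderiv_extChartAt (I := 𝓡 n) (mem_extChartAt_source (I := 𝓡 n) m)
    ext u
    have h2 := DFunLike.congr_fun (congrFun h m) fun i =>
      (mfderiv (𝓡 n) 𝓘(ℝ, EuclideanSpace ℝ (Fin n)) (extChartAt (𝓡 n) m) m).inverse (u i)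
    refine Eq.trans ?_ h2
    exact congrArg (extDeriv (α.inChart m) (extChartAt (𝓡 n) m m))
      (funext fun i => (hφ.self_apply_inverse (u i)).symm)
  · intro h
    funext m
    ext u
    exact DFunLike.congr_fun (h m) _

theorem FormField.d_d {k : ℕ} {α : FormField n M k} (hα : α ∈ smoothForms n M k) : α.d.d = 0 := by
  rw [FormField.d_eq_zero_iff]
  intro m
  have h : α.d.inChart m =ᶠ[nhds (extChartAt (𝓡 n) m m)] extDeriv (α.inChart m) := by
    filter_upwards [extChartAt_target_mem_nhds (I := 𝓡 n) m] with y hy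
      using FormField.inChart_d hα m hy
  rw [h.extDeriv_eq]
  exact extDeriv_extDeriv_apply (FormField.contDiffAt_inChart hα m) minSmoothness_two_le_infty

theorem FormField.interior_mem_smoothForms {k : ℕ} (X : VectorFields n M)
    {α : FormField n M (k + 1)} (hα : α ∈ smoothForms n M (k + 1)) :
    FormField.interior X α ∈ smoothForms n M k := by
  intro m₀
  refine ContDiffOn.congr ?_ fun y hy => FormField.inChart_interior X α m₀ hy
  have h := ContinuousLinearMap.contDiff (𝕜 := ℝ) (n := ∞)
    (E := EuclideanSpace ℝ (Fin n) [⋀^Fin (k + 1)]→L[ℝ] ℝ)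
    (F := EuclideanSpace ℝ (Fin n) →L[ℝ] EuclideanSpace ℝ (Fin n) [⋀^Fin k]→L[ℝ] ℝ)
    curryLeftLI.toContinuousLinearMap
  exact (h.comp_contDiffOn (hα m₀)).clm_apply (contDiffOn_vfInChart X m₀)

end Charts

/-! ### Cartan calculus for closed 3-forms on a manifold -/

section Cartan

variable {n : ℕ} {M : Type*} [TopologicalSpace M] [ChartedSpace (EuclideanSpace ℝ (Fin n)) M]
  [IsManifold (𝓡 n) ∞ M]

theorem FormField.interior_inChart_eventuallyEq {k : ℕ} (X : (m : M) → TangentSpace (𝓡 n) m)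
    (α : FormField n M (k + 1)) (m : M) :
    (FormField.interior X α).inChart m =ᶠ[nhds (extChartAt (𝓡 n) m m)]
      fun y => (α.inChart m y).curryLeft (vfInChart X m y) := by
  filter_upwards [extChartAt_target_mem_nhds (I := 𝓡 n) m] with y hy
    using FormField.inChart_interior X α m hy

theorem differentiableAt_vfInChart (X : VectorFields n M) (m : M) :
    DifferentiableAt ℝ (vfInChart (⇑X) m) (extChartAt (𝓡 n) m m) :=
  ((contDiffOn_vfInChart X m).contDiffAt (extChartAt_target_mem_nhds m)).differentiableAt (by simp)

variable {Ω : FormField n M 3}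

theorem FormField.extDeriv_interior_inChart_eq_zero {X : VectorFields n M}
    (hX : (FormField.interior X Ω).d = 0) (m : M) :
    extDeriv (fun y => (Ω.inChart m y).curryLeft (vfInChart (⇑X) m y))
      (extChartAt (𝓡 n) m m) = 0 := by
  rw [← (FormField.interior_inChart_eventuallyEq X Ω m).extDeriv_eq]
  exact (FormField.d_eq_zero_iff _).1 hX m

/-- `d ι_Y ι_X Ω = -ι_{[X, Y]} Ω` for fields `X`, `Y` whose contractions with the closed form `Ω`
are closed. -/
theorem FormField.d_interior_interior (hΩ : Ω ∈ smoothForms n M 3) (hc : Ω.d = 0)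
    {X Y : VectorFields n M}
    (hX : (FormField.interior X Ω).d = 0) (hY : (FormField.interior Y Ω).d = 0) :
    (FormField.interior Y (FormField.interior X Ω)).d =
      -FormField.interior (VectorField.mlieBracket (𝓡 n) X Y) Ω := by
  funext m
  have h1 := (FormField.interior_inChart_eventuallyEq Y (FormField.interior X Ω) m)
  have h2 : (FormField.interior Y (FormField.interior X Ω)).inChart m
      =ᶠ[nhds (extChartAt (𝓡 n) m m)] fun y =>
        ((Ω.inChart m y).curryLeft (vfInChart X m y)).curryLeft (vfInChart Y m y) := by
    filter_upwards [h1, FormField.interior_inChart_eventuallyEq X Ω m] with y h h'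
    rw [h, h']
  have h3 := extDeriv_interior_interior (FormField.differentiableAt_inChart hΩ m)
    (differentiableAt_vfInChart X m) (differentiableAt_vfInChart Y m)
    ((FormField.d_eq_zero_iff _).1 hc m)
    (FormField.extDeriv_interior_inChart_eq_zero hX m)
    (FormField.extDeriv_interior_inChart_eq_zero hY m)
  rw [← h2.extDeriv_eq] at h3
  ext u
  refine (DFunLike.congr_fun h3 _).trans ?_
  refine congrArg Neg.neg (Eq.symm ?_)
  refine (FormField.apply_eq_inChart Ω m (mem_extChartAt_source m) _).trans ?_
  refine congrArg (Ω.inChart m (extChartAt (𝓡 n) m m)) (funext fun i => ?_)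
  refine Fin.cases ?_ (fun j => ?_) i
  · exact mfderiv_mlieBracket X Y m
  · rfl

theorem FormField.apply₃_eq_inChart (Ω : FormField n M 3) (m : M) (a b c : TangentSpace (𝓡 n) m) :
    Ω m ![a, b, c] = Ω.inChart m (extChartAt (𝓡 n) m m)
      ![mfderiv (𝓡 n) 𝓘(ℝ, EuclideanSpace ℝ (Fin n)) (extChartAt (𝓡 n) m) m a,
        mfderiv (𝓡 n) 𝓘(ℝ, EuclideanSpace ℝ (Fin n)) (extChartAt (𝓡 n) m) m b,
        mfderiv (𝓡 n) 𝓘(ℝ, EuclideanSpace ℝ (Fin n)) (extChartAt (𝓡 n) m) m c] := by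
  refine (FormField.apply_eq_inChart Ω m (mem_extChartAt_source m) _).trans ?_
  refine congrArg (Ω.inChart m (extChartAt (𝓡 n) m m)) (funext fun i => ?_)
  fin_cases i <;> rfl

theorem FormField.hasMFDerivAt_apply₃ (hΩ : Ω ∈ smoothForms n M 3) (X Y Z : VectorFields n M)
    (m : M) :
    HasMFDerivAt (𝓡 n) 𝓘(ℝ, ℝ) (fun q => Ω q ![X q, Y q, Z q]) m
      ((fderiv ℝ (fun y => Ω.inChart m y ![vfInChart X m y, vfInChart Y m y, vfInChart Z m y])
        (extChartAt (𝓡 n) m m)).comp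
        (mfderiv (𝓡 n) 𝓘(ℝ, EuclideanSpace ℝ (Fin n)) (extChartAt (𝓡 n) m) m)) := by
  have : IsManifold (𝓡 n) 1 M := .of_le (n := ∞) (by simp)
  have hd := (differentiableAt_alt₃_apply (FormField.differentiableAt_inChart hΩ m)
    (differentiableAt_vfInChart X m) (differentiableAt_vfInChart Y m)
    (differentiableAt_vfInChart Z m)).hasFDerivAt
  have hφ := (mdifferentiableAt_extChartAt (I := 𝓡 n) (mem_chart_source _ m)).hasMFDerivAt
  refine (HasMFDerivAt.comp m hd.hasMFDerivAt hφ).congr_of_eventuallyEq ?_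
  filter_upwards [extChartAt_source_mem_nhds (I := 𝓡 n) m] with q hq
  refine (FormField.apply_eq_inChart Ω m hq _).trans ?_
  refine congrArg (Ω.inChart m (extChartAt (𝓡 n) m q)) (funext fun i => ?_)
  fin_cases i
  · exact (vfInChart_extChartAt X m hq).symm
  · exact (vfInChart_extChartAt Y m hq).symm
  · exact (vfInChart_extChartAt Z m hq).symm

/-- The differential of `Ω(X, Y, Z)` in an arbitrary direction `w`, for fields `X`, `Y`, `Z` whose
contractions with the closed form `Ω` are closed. It matches the differential of the right-hand
side of the trinary moment map equation. -/
theorem FormField.mfderiv_apply₃_eq (hΩ : Ω ∈ smoothForms n M 3) (hc : Ω.d = 0)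
    {X Y Z : VectorFields n M}
    (hX : (FormField.interior X Ω).d = 0) (hY : (FormField.interior Y Ω).d = 0)
    (hZ : (FormField.interior Z Ω).d = 0) (m : M) (w : TangentSpace (𝓡 n) m) :
    mfderiv (𝓡 n) 𝓘(ℝ, ℝ) (fun q => Ω q ![X q, Y q, Z q]) m w =
      -Ω m ![X m, VectorField.mlieBracket (𝓡 n) Y Z m, w]
        + Ω m ![Y m, VectorField.mlieBracket (𝓡 n) X Z m, w]
        - Ω m ![Z m, VectorField.mlieBracket (𝓡 n) X Y m, w] := by
  rw [(FormField.hasMFDerivAt_apply₃ hΩ X Y Z m).mfderiv]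
  refine (fderiv_alt₃_eq (FormField.differentiableAt_inChart hΩ m)
    (differentiableAt_vfInChart X m) (differentiableAt_vfInChart Y m)
    (differentiableAt_vfInChart Z m) ((FormField.d_eq_zero_iff _).1 hc m)
    (FormField.extDeriv_interior_inChart_eq_zero hX m)
    (FormField.extDeriv_interior_inChart_eq_zero hY m)
    (FormField.extDeriv_interior_inChart_eq_zero hZ m) _).trans ?_
  simp only [FormField.apply₃_eq_inChart, mfderiv_mlieBracket,
    vfInChart_extChartAt _ m (mem_extChartAt_source m)]
  rfl

/-- The differential of `Ω(X, Y, Z)` along a field `W` that preserves the closed form `Ω`. -/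
theorem FormField.mfderiv_apply₃_of_invariant (hΩ : Ω ∈ smoothForms n M 3) (hc : Ω.d = 0)
    (X Y Z : VectorFields n M) {W : VectorFields n M}
    (hW : (FormField.interior W Ω).d = 0) (m : M) :
    mfderiv (𝓡 n) 𝓘(ℝ, ℝ) (fun q => Ω q ![X q, Y q, Z q]) m (W m) =
      Ω m ![VectorField.mlieBracket (𝓡 n) W X m, Y m, Z m]
        + Ω m ![X m, VectorField.mlieBracket (𝓡 n) W Y m, Z m]
        + Ω m ![X m, Y m, VectorField.mlieBracket (𝓡 n) W Z m] := by
  rw [(FormField.hasMFDerivAt_apply₃ hΩ X Y Z m).mfderiv]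
  refine Eq.trans ?_ ((fderiv_alt₃_of_invariant (FormField.differentiableAt_inChart hΩ m)
    (differentiableAt_vfInChart X m) (differentiableAt_vfInChart Y m)
    (differentiableAt_vfInChart Z m) (differentiableAt_vfInChart W m)
    ((FormField.d_eq_zero_iff _).1 hc m)
    (FormField.extDeriv_interior_inChart_eq_zero hW m)).trans ?_)
  · rw [vfInChart_extChartAt _ m (mem_extChartAt_source m)]
    rfl
  simp only [FormField.apply₃_eq_inChart, mfderiv_mlieBracket,
    vfInChart_extChartAt _ m (mem_extChartAt_source m)]

/-- A function with vanishing differential on a connected manifold is constant. -/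
theorem eq_of_mfderiv_eq_zero [PreconnectedSpace M] {f : M → ℝ}
    (hf : ∀ m, HasMFDerivAt (𝓡 n) 𝓘(ℝ, ℝ) f m 0) (a b : M) : f a = f b := by
  have : IsManifold (𝓡 n) 1 M := .of_le (n := ∞) (by simp)
  refine IsLocallyConstant.apply_eq_of_preconnectedSpace
    ((IsLocallyConstant.iff_eventually_eq f).2 fun m => ?_) a b
  obtain ⟨r, hr, hball⟩ := Metric.mem_nhds_iff.1 (extChartAt_target_mem_nhds (I := 𝓡 n) m)
  have hd : ∀ y ∈ Metric.ball (extChartAt (𝓡 n) m m) r,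
      HasFDerivAt (f ∘ (extChartAt (𝓡 n) m).symm) (0 : EuclideanSpace ℝ (Fin n) →L[ℝ] ℝ) y := by
    intro y hy
    have h1 : MDifferentiableAt 𝓘(ℝ, EuclideanSpace ℝ (Fin n)) (𝓡 n)
        (extChartAt (𝓡 n) m).symm y :=
      ((contMDiffOn_extChartAt_symm (n := 1) m).contMDiffAt
        ((isOpen_extChartAt_target m).mem_nhds (hball hy))).mdifferentiableAt (by simp)
    have h2 := (hf _).comp y h1.hasMFDerivAt
    rw [hasMFDerivAt_iff_hasFDerivAt] at h2
    refine h2.congr_fderiv ?_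
    ext v; rfl
  have hmem := (continuousAt_extChartAt (I := 𝓡 n) m).preimage_mem_nhds
    (Metric.ball_mem_nhds _ hr)
  filter_upwards [hmem, extChartAt_source_mem_nhds (I := 𝓡 n) m] with q hq hqs
  have h := Metric.isOpen_ball.is_const_of_fderiv_eq_zero
    (convex_ball (extChartAt (𝓡 n) m m) r).isPreconnected
    (fun y hy => (hd y hy).differentiableAt.differentiableWithinAt)
    (fun y hy => (hd y hy).fderiv) hq (Metric.mem_ball_self hr)
  rwa [Function.comp_apply, Function.comp_apply, (extChartAt (𝓡 n) m).left_inv hqs,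
    extChartAt_to_inv] at h

end Cartan

/-! ### Cohomology classes of Lie algebras and of `CE(L)` -/

section Algebra

variable {𝔤 𝔥 : Type*} [LieRing 𝔤] [LieAlgebra ℝ 𝔤] [AddCommGroup 𝔥] [Module ℝ 𝔥]

/-- A cochain with values in a trivial representation is a coboundary once all its coordinates
are. -/
theorem mem_lieCoboundaries₃_of_coords {V ι : Type*} [AddCommGroup V] [Module ℝ V] [Fintype ι]
    (b : Module.Basis ι ℝ V) (θ : 𝔤 [⋀^Fin 3]→ₗ[ℝ] V)
    (h : ∀ i, (b.coord i).compAlternatingMap θ ∈ lieCoboundaries₃ (trivialRep 𝔤 ℝ)) :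
    θ ∈ lieCoboundaries₃ (trivialRep 𝔤 V) := by
  choose φ hφ using h
  refine ⟨∑ i, (LinearMap.toSpanSingleton ℝ V (b i)).compAlternatingMap (φ i), fun x y z => ?_⟩
  have hsum : ∀ v : Fin 2 → 𝔤,
      (∑ i, (LinearMap.toSpanSingleton ℝ V (b i)).compAlternatingMap (φ i)) v =
        ∑ i, φ i v • b i := fun v =>
    map_sum (⟨⟨fun f => f v, rfl⟩, fun _ _ => rfl⟩ : (𝔤 [⋀^Fin 2]→ₗ[ℝ] V) →+ V) _ _
  rw [← b.sum_repr (θ ![x, y, z])]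
  have h' : ∀ i, b.repr (θ ![x, y, z]) i = ceDiff₂ (trivialRep 𝔤 ℝ) (φ i) x y z :=
    fun i => hφ i x y z
  simp only [h', ceDiff₂, LieHom.zero_apply, LinearMap.zero_apply, hsum, sub_smul, add_smul,
    Finset.sum_sub_distrib, Finset.sum_add_distrib, zero_smul, Finset.sum_const_zero]

theorem comp_mem_lieCocycles₃ {V W : Type*} [AddCommGroup V] [Module ℝ V] [AddCommGroup W]
    [Module ℝ W] (f : V →ₗ[ℝ] W) {θ : 𝔤 [⋀^Fin 3]→ₗ[ℝ] V}
    (hθ : θ ∈ lieCocycles₃ (trivialRep 𝔤 V)) :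
    f.compAlternatingMap θ ∈ lieCocycles₃ (trivialRep 𝔤 W) := by
  intro x y z u
  have h := congrArg f (hθ x y z u)
  simpa [ceDiff₃] using h

theorem lieClass₃_eq_zero_iff {V : Type*} [AddCommGroup V] [Module ℝ V]
    {ρ : 𝔤 →ₗ⁅ℝ⁆ Module.End ℝ V} {θ : 𝔤 [⋀^Fin 3]→ₗ[ℝ] V} (hθ : θ ∈ lieCocycles₃ ρ) :
    lieClass₃ ρ θ hθ = 0 ↔ θ ∈ lieCoboundaries₃ ρ :=
  Submodule.Quotient.mk_eq_zero _

theorem smul_lieClass₃_eq_iff {V : Type*} [AddCommGroup V] [Module ℝ V]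
    {ρ : 𝔤 →ₗ⁅ℝ⁆ Module.End ℝ V} {θ θ' : 𝔤 [⋀^Fin 3]→ₗ[ℝ] V} (hθ : θ ∈ lieCocycles₃ ρ)
    (hθ' : θ' ∈ lieCocycles₃ ρ) (t : ℝ) :
    t • lieClass₃ ρ θ hθ = lieClass₃ ρ θ' hθ' ↔ t • θ - θ' ∈ lieCoboundaries₃ ρ := by
  rw [lieClass₃, lieClass₃, ← Submodule.Quotient.mk_smul, Submodule.Quotient.eq]
  rfl

namespace MinimalLie2Algebra

variable (L : MinimalLie2Algebra 𝔤 𝔥)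

/-- If `H³(𝔤)` is one-dimensional and `[c_red] ≠ 0`, every `3`-cocycle `θ` of `𝔤` is exact in
`CE(L)`. Some coordinate `ξ` of `𝔥 / [𝔤, 𝔥]` gives `[ξ ∘ c_red] ≠ 0`, which spans `H³(𝔤)`; so `θ`
is a multiple of `ξ ∘ c_red` up to a coboundary of `𝔤`, and `ξ ∘ c` is exact in `CE(L)` because
`ξ` kills `[𝔤, 𝔥]`. -/
theorem exists_primitive [FiniteDimensional ℝ 𝔥] {θ : 𝔤 [⋀^Fin 3]→ₗ[ℝ] ℝ}
    (hθ : θ ∈ lieCocycles₃ (trivialRep 𝔤 ℝ))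
    (hdim : Module.finrank ℝ (LieH₃ (trivialRep 𝔤 ℝ)) = 1) (hred : L.cRedClass ≠ 0) :
    ∃ η : CE₂ 𝔤 𝔥, (∀ x y z, θ ![x, y, z] = L.d₂g η x y z) ∧ ∀ x h, L.d₂h η x h = 0 := by
  -- a coordinate of `c_red` that is not a coboundary
  let b := Module.finBasis ℝ (𝔥 ⧸ L.bracketSpan)
  obtain ⟨i, hi⟩ : ∃ i, (b.coord i).compAlternatingMap L.cRed ∉
      lieCoboundaries₃ (trivialRep 𝔤 ℝ) := by
    by_contra! h
    exact hred ((lieClass₃_eq_zero_iff L.cRed_mem).2 (mem_lieCoboundaries₃_of_coords b _ h))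
  have hcoc := comp_mem_lieCocycles₃ (b.coord i) L.cRed_mem
  obtain ⟨t, ht⟩ := (finrank_eq_one_iff_of_nonzero' (lieClass₃ _ _ hcoc)
    (mt (lieClass₃_eq_zero_iff hcoc).1 hi)).1 hdim (lieClass₃ _ θ hθ)
  obtain ⟨φ, hφ⟩ : t • (b.coord i).compAlternatingMap L.cRed - θ ∈
      lieCoboundaries₃ (trivialRep 𝔤 ℝ) :=
    (smul_lieClass₃_eq_iff hcoc hθ t).1 ht
  refine ⟨(-t • (b.coord i ∘ₗ L.bracketSpan.mkQ), -φ), fun x y z => ?_, fun x h => ?_⟩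
  · have h := hφ x y z
    simp only [AlternatingMap.sub_apply, AlternatingMap.smul_apply,
      LinearMap.compAlternatingMap_apply, cRed, ceDiff₂, LieHom.zero_apply, LinearMap.zero_apply,
      smul_eq_mul] at h
    simp only [d₂g, ceDiff₂, LieHom.zero_apply, LinearMap.zero_apply, AlternatingMap.neg_apply,
      LinearMap.smul_apply, LinearMap.comp_apply, smul_eq_mul]
    linarith
  · have h0 : L.bracketSpan.mkQ (L.act x h) = 0 := by
      rw [Submodule.mkQ_apply, Submodule.Quotient.mk_eq_zero]
      exact Submodule.subset_span ⟨x, h, rfl⟩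
    simp [d₂h, h0]

theorem exists_ceClass₃_eq_zero {θ : 𝔤 [⋀^Fin 3]→ₗ[ℝ] ℝ}
    (hθ : θ ∈ lieCocycles₃ (trivialRep 𝔤 ℝ)) {η : CE₂ 𝔤 𝔥}
    (hη : ∀ x y z, θ ![x, y, z] = L.d₂g η x y z) (hη' : ∀ x h, L.d₂h η x h = 0) :
    ∃ hc : CE₃.ofAlt 𝔥 θ ∈ L.ceCocycles₃, L.ceClass₃ (.ofAlt 𝔥 θ) hc = 0 := by
  refine ⟨⟨fun x y z u => ?_, fun x y h => ?_⟩, ?_⟩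
  · have := hθ x y z u
    simpa [d₃g, CE₃.ofAlt] using this
  · simp [d₃h, CE₃.ofAlt]
  · exact (Submodule.Quotient.mk_eq_zero _).2 ⟨η, hη, fun x h => (hη' x h).symm⟩

end MinimalLie2Algebra

/-- The alternating map on two arguments given by an alternating bilinear map. -/
def LinearMap.toAlternatingTwo {R N V : Type*} [CommSemiring R] [AddCommMonoid N] [Module R N]
    [AddCommMonoid V] [Module R V] (B : N →ₗ[R] N →ₗ[R] V) (hB : ∀ x, B x x = 0) :
    N [⋀^Fin 2]→ₗ[R] V where
  toFun v := B (v 0) (v 1)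
  map_update_add' := by
    intro _ v i x y
    fin_cases i <;> simp
  map_update_smul' := by
    intro _ v i r x
    fin_cases i <;> simp
  map_eq_zero_of_eq' := by
    intro v i j h hij
    fin_cases i <;> fin_cases j <;> simp_all

theorem LinearMap.exists_section_range {K V W : Type*} [Field K] [AddCommGroup V] [Module K V]
    [AddCommGroup W] [Module K W] (D : V →ₗ[K] W) :
    ∃ s : LinearMap.range D →ₗ[K] V, ∀ w, D (s w) = w := by
  obtain ⟨s, hs⟩ := D.rangeRestrict.exists_rightInverse_of_surjective D.range_rangeRestrict
  exact ⟨s, fun w => congrArg Subtype.val (LinearMap.congr_fun hs w)⟩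

end Algebra

/-! ### Hamiltonian actions and construction of the moment map -/

section Moment

variable {n : ℕ} {M : Type*} [TopologicalSpace M] [ChartedSpace (EuclideanSpace ℝ (Fin n)) M]
  [IsManifold (𝓡 n) ∞ M] {Ω : FormField n M 3}

/-- Nondegeneracy makes the Hamiltonian vector field of a form unique, so that `hamVF` returns it.
-/
theorem hamVF_eq (hΩ : IsTwoPlectic Ω) {α : FormField n M 1} {X : VectorFields n M}
    (h : IsHamiltonianFor Ω α X) : hamVF Ω α = X := by
  have hex : ∃ X : VectorFields n M, IsHamiltonianFor Ω α X := ⟨X, h⟩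
  have hY : IsHamiltonianFor Ω α (hamVF Ω α) := by
    rw [hamVF, dif_pos hex]; exact hex.choose_spec
  ext1 m
  refine sub_eq_zero.1 (hΩ.nondegenerate m _ fun a b => ?_)
  have e := DFunLike.congr_fun (congrFun (neg_injective (hY.symm.trans h)) m) ![a, b]
  exact (alt₃_sub₀ (E := EuclideanSpace ℝ (Fin n)) (Ω m) _ _ a b).trans (sub_eq_zero.2 e)

/-- A Hamiltonian vector field has closed contraction with `Ω`, as `ι_X Ω = -dα` and `d² = 0`. -/
theorem IsHamiltonianFor.d_interior {α : FormField n M 1} (hα : α ∈ smoothForms n M 1)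
    {X : VectorFields n M} (h : IsHamiltonianFor Ω α X) : (FormField.interior X Ω).d = 0 := by
  have e : FormField.interior X Ω = (-1 : ℝ) • α.d := by
    rw [show α.d = _ from h]; module
  rw [e, FormField.d_smul, FormField.d_d hα, smul_zero]

variable {𝔤 𝔥 : Type*} [LieRing 𝔤] [LieAlgebra ℝ 𝔤] [AddCommGroup 𝔥] [Module ℝ 𝔥]

namespace HamiltonianAction

variable (A : HamiltonianAction 𝔤 Ω)

theorem d_interior (x : 𝔤) : (FormField.interior (A.v x) Ω).d = 0 := by
  obtain ⟨α, hα, h⟩ := A.hamiltonian x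
  exact h.d_interior hα

theorem omega₃_apply (p : M) (x y z : 𝔤) :
    A.omega₃ p ![x, y, z] = Ω p ![A.v x p, A.v y p, A.v z p] := by
  refine congrArg (Ω p) (funext fun i => ?_)
  fin_cases i <;> rfl

/-- `Ω_{3p}` is a cocycle: comparing the two formulas for `v_u (Ω(v_x, v_y, v_z))` at `p`, one
from closedness of `Ω` together with invariance under `v_x`, `v_y`, `v_z`, the other from
invariance under `v_u`, gives the cocycle identity. -/
theorem omega₃_mem_lieCocycles₃ (hΩ : IsTwoPlectic Ω) (p : M) :
    A.omega₃ p ∈ lieCocycles₃ (trivialRep 𝔤 ℝ) := by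
  intro x y z u
  have h1 := FormField.mfderiv_apply₃_eq hΩ.smooth hΩ.closed (A.d_interior x) (A.d_interior y)
    (A.d_interior z) p (A.v u p)
  have h2 := FormField.mfderiv_apply₃_of_invariant hΩ.smooth hΩ.closed (A.v x) (A.v y) (A.v z)
    (A.d_interior u) p
  simp only [← A.map_lie, ← A.omega₃_apply] at h1 h2
  -- stated as an equation in `ℝ`, since both formulas live in a tangent space of `ℝ`
  have h3 : -A.omega₃ p ![x, ⁅y, z⁆, u] + A.omega₃ p ![y, ⁅x, z⁆, u] - A.omega₃ p ![z, ⁅x, y⁆, u]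
      = A.omega₃ p ![⁅u, x⁆, y, z] + A.omega₃ p ![x, ⁅u, y⁆, z] + A.omega₃ p ![x, y, ⁅u, z⁆] :=
    h1.symm.trans h2
  rw [← lie_skew u x, ← lie_skew u y, ← lie_skew u z] at h3
  simp only [ceDiff₃, LieHom.zero_apply, LinearMap.zero_apply]
  generalize A.omega₃ p = θ at h3 ⊢
  have s01 : ∀ a b c, θ ![a, b, c] = -θ ![b, a, c] := θ.map_swap₀₁
  have s12 : ∀ a b c, θ ![a, b, c] = -θ ![a, c, b] := θ.map_swap₁₂
  have hn : ∀ a b c, θ ![-a, b, c] = -θ ![a, b, c] := θ.map_neg₀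
  rw [s01 x (-⁅y, u⁆), s12 x y, s01 x (-⁅z, u⁆), hn, hn, hn, s01 x ⁅y, z⁆, s01 y ⁅x, z⁆,
    s01 z ⁅x, y⁆] at h3
  linarith

/-- Hamiltonian `1`-forms for the `v_x` can be chosen smooth and linear in `x`. -/
theorem exists_linear_hamiltonian :
    ∃ f : 𝔤 →ₗ[ℝ] smoothForms n M 1, ∀ x, IsHamiltonianFor Ω (f x) (A.v x) := by
  choose α hα h using A.hamiltonian
  let b := Module.Basis.ofVectorSpace ℝ 𝔤
  let f : 𝔤 →ₗ[ℝ] smoothForms n M 1 := b.constr ℝ fun i => ⟨α (b i), hα (b i)⟩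
  let D : smoothForms n M 1 →ₗ[ℝ] FormField n M 2 :=
    { toFun := fun β => FormField.d (β : FormField n M 1)
      map_add' := fun β γ => FormField.d_add β.2 γ.2
      map_smul' := fun r β => FormField.d_smul r _ }
  let C : 𝔤 →ₗ[ℝ] FormField n M 2 :=
    { toFun := fun x => -FormField.interior (A.v x) Ω
      map_add' := fun x y => by
        rw [map_add, ContMDiffSection.coe_add, FormField.interior_add_left, neg_add]
      map_smul' := fun r x => by
        rw [map_smul, ContMDiffSection.coe_smul, FormField.interior_smul_left,
          RingHom.id_apply, smul_neg] }
  have hDC : D ∘ₗ f = C := b.ext fun i => by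
    have hf : f (b i) = ⟨α (b i), hα (b i)⟩ := b.constr_basis ℝ _ i
    rw [LinearMap.comp_apply, hf]
    exact h (b i)
  exact ⟨f, fun x => LinearMap.congr_fun hDC x⟩

/-- The bilinear map `(x, y) ↦ f [x, y] - ι_{v_y} ι_{v_x} Ω`, with values in `1`-forms; the
component `f₂` of a moment map extending `f` is a primitive of it. -/
def bracketForm (f : 𝔤 →ₗ[ℝ] smoothForms n M 1) : 𝔤 →ₗ[ℝ] 𝔤 →ₗ[ℝ] FormField n M 1 :=
  LinearMap.mk₂ ℝ (fun x y => (f ⁅x, y⁆ : FormField n M 1) -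
      FormField.interior (A.v y) (FormField.interior (A.v x) Ω))
    (fun x x' y => by
      rw [add_lie, map_add, map_add, ContMDiffSection.coe_add, FormField.interior_add_left,
        FormField.interior_add_right, Submodule.coe_add]
      abel)
    (fun r x y => by
      rw [smul_lie, map_smul, map_smul, ContMDiffSection.coe_smul, FormField.interior_smul_left,
        FormField.interior_smul_right, Submodule.coe_smul, smul_sub])
    (fun x y y' => by
      rw [lie_add, map_add, map_add, ContMDiffSection.coe_add, FormField.interior_add_left,
        Submodule.coe_add]
      abel)
    (fun r x y => by
      rw [lie_smul, map_smul, map_smul, ContMDiffSection.coe_smul, FormField.interior_smul_left,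
        Submodule.coe_smul, smul_sub])

theorem bracketForm_self (f : 𝔤 →ₗ[ℝ] smoothForms n M 1) (x : 𝔤) : A.bracketForm f x x = 0 := by
  change (f ⁅x, x⁆ : FormField n M 1) - _ = 0
  rw [lie_self, map_zero, FormField.interior_interior_self, Submodule.coe_zero, sub_zero]

variable {A} in
/-- The form `f [x, y] - ι_{v_y} ι_{v_x} Ω` is closed, hence exact if `H¹(M) = 0`. -/
theorem bracketForm_mem_range (hΩ : IsTwoPlectic Ω) (hH : FirstDeRhamVanishes n M)
    {f : 𝔤 →ₗ[ℝ] smoothForms n M 1} (hf : ∀ x, IsHamiltonianFor Ω (f x) (A.v x)) (x y : 𝔤) :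
    A.bracketForm f x y ∈ LinearMap.range (dFunₗ n M) := by
  have hs : FormField.interior (A.v y) (FormField.interior (A.v x) Ω) ∈ smoothForms n M 1 :=
    FormField.interior_mem_smoothForms (A.v y)
      (FormField.interior_mem_smoothForms (A.v x) hΩ.smooth)
  have hb : (⇑(A.v ⁅x, y⁆) : (m : M) → TangentSpace (𝓡 n) m) =
    VectorField.mlieBracket (𝓡 n) (A.v x) (A.v y) := funext (A.map_lie x y)
  have hd : FormField.d ((f ⁅x, y⁆ : FormField n M 1) -
      FormField.interior (A.v y) (FormField.interior (A.v x) Ω)) = 0 := by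
    rw [FormField.d_sub (f ⁅x, y⁆).2 hs, FormField.d_interior_interior hΩ.smooth hΩ.closed
      (A.d_interior x) (A.d_interior y), ← hb]
    exact sub_eq_zero.2 (hf ⁅x, y⁆)
  obtain ⟨h, hh⟩ := hH _ ((smoothForms n M 1).sub_mem (f ⁅x, y⁆).2 hs) hd
  exact ⟨h, hh⟩

/-- Primitives of `bracketForm` can be chosen smooth, alternating in `(x, y)`, and with prescribed
values `φ(x, y)` at `p`. -/
theorem exists_primitive_bracketForm (hΩ : IsTwoPlectic Ω) (hH : FirstDeRhamVanishes n M)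
    {f : 𝔤 →ₗ[ℝ] smoothForms n M 1} (hf : ∀ x, IsHamiltonianFor Ω (f x) (A.v x)) (p : M)
    (φ : 𝔤 [⋀^Fin 2]→ₗ[ℝ] ℝ) :
    ∃ f₂ : 𝔤 [⋀^Fin 2]→ₗ[ℝ] C^∞⟮𝓡 n, M; ℝ⟯,
      (∀ x y, dFunₗ n M (f₂ ![x, y]) = A.bracketForm f x y) ∧ ∀ x y, f₂ ![x, y] p = φ ![x, y] := by
  obtain ⟨s, hs⟩ := (dFunₗ n M).exists_section_range
  let B : 𝔤 →ₗ[ℝ] 𝔤 →ₗ[ℝ] LinearMap.range (dFunₗ n M) := LinearMap.mk₂ ℝ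
    (fun x y => ⟨A.bracketForm f x y, bracketForm_mem_range hΩ hH hf x y⟩)
    (fun x x' y => Subtype.ext (by simp)) (fun r x y => Subtype.ext (by simp))
    (fun x y y' => Subtype.ext (by simp)) (fun r x y => Subtype.ext (by simp))
  have hB : ∀ x, B x x = 0 := fun x => Subtype.ext (bracketForm_self A f x)
  let g : 𝔤 [⋀^Fin 2]→ₗ[ℝ] C^∞⟮𝓡 n, M; ℝ⟯ := s.compAlternatingMap (B.toAlternatingTwo hB)
  let ev : C^∞⟮𝓡 n, M; ℝ⟯ →ₗ[ℝ] ℝ :=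
    { toFun := fun h => h p, map_add' := fun _ _ => rfl, map_smul' := fun _ _ => rfl }
  -- adding constants leaves the differential unchanged and corrects the values at `p`
  refine ⟨g + (Algebra.linearMap ℝ C^∞⟮𝓡 n, M; ℝ⟯).compAlternatingMap
    (φ - ev.compAlternatingMap g), fun x y => ?_, fun x y => ?_⟩
  · rw [AlternatingMap.add_apply, map_add]
    refine (congrArg₂ (· + ·) (hs (B x y)) (dFun_const _)).trans (add_zero _)
  · change g ![x, y] p + (φ ![x, y] - g ![x, y] p) = φ ![x, y]
    ring

/-- A primitive `η = (ξ, φ)` of `Ω_{3p}` in `CE(L)` yields a moment map. On `𝔥` it is `ξ`, with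
values in constant functions, and `f₂` is chosen with `f₂(x, y)(p) = φ(x, y)`. The two sides of
the trinary equation have the same differential and agree at `p` by the choice of `η`, so
connectedness of `M` gives equality. -/
theorem nonempty_momentMap [ConnectedSpace M] (hΩ : IsTwoPlectic Ω)
    (hH : FirstDeRhamVanishes n M) (L : MinimalLie2Algebra 𝔤 𝔥) (p : M)
    {η : MinimalLie2Algebra.CE₂ 𝔤 𝔥} (hη : ∀ x y z, A.omega₃ p ![x, y, z] = L.d₂g η x y z)
    (hη' : ∀ x h, L.d₂h η x h = 0) : Nonempty (MomentMap A L) := by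
  obtain ⟨f, hf⟩ := A.exists_linear_hamiltonian
  obtain ⟨f₂, hf₂, hp⟩ := A.exists_primitive_bracketForm hΩ hH hf p η.2
  have hv : ∀ x, hamVF Ω (f x : FormField n M 1) = A.v x := fun x => hamVF_eq hΩ (hf x)
  refine ⟨{ f₁ := f, f₁h := Algebra.linearMap ℝ C^∞⟮𝓡 n, M; ℝ⟯ ∘ₗ η.1, f₂ := f₂,
            unary := fun h => dFun_const (η.1 h), binary := fun x y => ?_,
            binary_h := fun x h => ?_, trinary := fun x y z m => ?_, moment := hf }⟩
  · refine (hf₂ x y).trans ?_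
    have hz : zetaSign 2 = 1 := by norm_num [zetaSign]
    rw [obsBracket₂, hv, hv, hz, one_smul]
    rfl
  · rw [LinearMap.comp_apply, ← neg_eq_zero, ← map_neg]
    exact (congrArg _ (hη' x h)).trans (map_zero _)
  · have hz : zetaSign 3 = -1 := by norm_num [zetaSign]
    have hconst := eq_of_mfderiv_eq_zero (n := n)
      (f := fun q => Ω q ![A.v x q, A.v y q, A.v z q] - f₂ ![x, ⁅y, z⁆] q + f₂ ![y, ⁅x, z⁆] q
        - f₂ ![z, ⁅x, y⁆] q) (fun q => ?_) m p
    · have h1 := hη x y z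
      rw [A.omega₃_apply] at h1
      simp only [MinimalLie2Algebra.d₂g, ceDiff₂, LieHom.zero_apply, LinearMap.zero_apply] at h1
      simp only [hp] at hconst
      have hc : ∀ t : ℝ, (Algebra.linearMap ℝ C^∞⟮𝓡 n, M; ℝ⟯ t) m = t := fun t => rfl
      rw [obsBracket₃, hv, hv, hv, hz, LinearMap.comp_apply, hc]
      have s2 : ∀ a b, η.2 ![a, b] = -η.2 ![b, a] := η.2.map_swap_two
      rw [s2 ⁅x, y⁆, s2 ⁅x, z⁆, s2 ⁅y, z⁆] at h1
      linarith
    · have hΩd :=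
        (FormField.hasMFDerivAt_apply₃ hΩ.smooth (A.v x) (A.v y) (A.v z) q).mdifferentiableAt
      have hd := (((hΩd.hasMFDerivAt.sub
        (mdifferentiable_smooth (f₂ ![x, ⁅y, z⁆]) q).hasMFDerivAt).add
        (mdifferentiable_smooth (f₂ ![y, ⁅x, z⁆]) q).hasMFDerivAt).sub
        (mdifferentiable_smooth (f₂ ![z, ⁅x, y⁆]) q).hasMFDerivAt)
      refine hd.congr_mfderiv ?_
      -- the contributions of `f` cancel by the Jacobi identity
      have hJ : (f ⁅x, ⁅y, z⁆⁆ : FormField n M 1) + f ⁅z, ⁅x, y⁆⁆ = f ⁅y, ⁅x, z⁆⁆ := by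
        have h0 : ⁅x, ⁅y, z⁆⁆ + ⁅z, ⁅x, y⁆⁆ = ⁅y, ⁅x, z⁆⁆ := by
          rw [leibniz_lie x y z, ← lie_skew z, add_assoc, add_comm, add_assoc, neg_add_cancel,
            add_zero]
        rw [← h0, map_add, Submodule.coe_add]
      ext w
      have hJw := DFunLike.congr_fun (congrFun hJ q) ![w]
      have e := FormField.mfderiv_apply₃_eq hΩ.smooth hΩ.closed (A.d_interior x) (A.d_interior y)
        (A.d_interior z) q w
      have e1 := mfderiv_eq_of_dFun_eq (hf₂ x ⁅y, z⁆) q w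
      have e2 := mfderiv_eq_of_dFun_eq (hf₂ y ⁅x, z⁆) q w
      have e3 := mfderiv_eq_of_dFun_eq (hf₂ z ⁅x, y⁆) q w
      have hb : ∀ a b c, A.bracketForm f a ⁅b, c⁆ q ![w] = (f ⁅a, ⁅b, c⁆⁆ : FormField n M 1) q ![w]
          - Ω q ![A.v a q, VectorField.mlieBracket (𝓡 n) (A.v b) (A.v c) q, w] := fun a b c => by
        rw [← A.map_lie]; rfl
      rw [hb] at e1 e2 e3
      refine (congrArg₂ (fun s t : ℝ => s - t) (congrArg₂ (fun s t : ℝ => s + t)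
        (congrArg₂ (fun s t : ℝ => s - t) e e1) e2) e3).trans ?_
      have hJ' : (f ⁅x, ⁅y, z⁆⁆ : FormField n M 1) q ![w] + (f ⁅z, ⁅x, y⁆⁆ : FormField n M 1) q ![w]
        = (f ⁅y, ⁅x, z⁆⁆ : FormField n M 1) q ![w] := hJw
      change (_ : ℝ) = 0
      linarith

end HamiltonianAction
end Moment

end

theorem mainTheorem8
    {n : ℕ} {M : Type*} [TopologicalSpace M] [T2Space M] [SecondCountableTopology M]
    [ConnectedSpace M] [ChartedSpace (EuclideanSpace ℝ (Fin n)) M] [IsManifold (𝓡 n) ∞ M]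
    (Ω : FormField n M 3) (hΩ : IsTwoPlectic Ω)
    {𝔤 : Type*} [LieRing 𝔤] [LieAlgebra ℝ 𝔤] [FiniteDimensional ℝ 𝔤]
    {𝔥 : Type*} [AddCommGroup 𝔥] [Module ℝ 𝔥] [FiniteDimensional ℝ 𝔥]
    (A : HamiltonianAction 𝔤 Ω) (L : MinimalLie2Algebra 𝔤 𝔥) (p : M)
    (hΩ₃ : ∀ hc : A.omega₃ p ∈ lieCocycles₃ (trivialRep 𝔤 ℝ),
      lieClass₃ (trivialRep 𝔤 ℝ) (A.omega₃ p) hc ≠ 0)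
    (hdim : Module.finrank ℝ (LieH₃ (trivialRep 𝔤 ℝ)) = 1)
    (hred : L.cRedClass ≠ 0) :
    (∃ hc : MinimalLie2Algebra.CE₃.ofAlt 𝔥 (A.omega₃ p) ∈ L.ceCocycles₃,
      L.ceClass₃ (.ofAlt 𝔥 (A.omega₃ p)) hc = 0) ∧
    (FirstDeRhamVanishes n M → Nonempty (MomentMap A L)) := by
  have hcoc := A.omega₃_mem_lieCocycles₃ hΩ p
  obtain ⟨η, hη, hη'⟩ := L.exists_primitive hcoc hdim hred
  exact ⟨L.exists_ceClass₃_eq_zero hcoc hη hη', fun hH => A.nonempty_momentMap hΩ hH L p hη hη'⟩
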